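/- Let $K$ be a non-archimedean local field of residue characteristic $2$ and let $L/K$ be a separable quadratic ramified extension, with rings of integers $\mathcal O_K\subset\mathcal O_L$. Let $x\mapsto\bar x$ be the nontrivial element of $\mathrm{Gal}(L/K)$ and $\omega$ the valuation. For a $3\times3$ matrix $g$, let ${}^{S}g$ be its transpose along the anti-diagonal, $({}^{S}g)_{ij}=g_{4-j,4-i}$. Let $\mathrm{SU}_3^{L/K}$ be the algebraic group over $K$ whose points over a $K$-algebra $S$ are the $g\in\mathrm{SL}_3(S\otimes_KL)$ with ${}^{S}\bar g\,g=\mathrm{Id}$. There are $s\in L$ and $\alpha,\beta_0\in\mathcal O_K$ with $L=K[s]$ and $s^2-\alpha s+\beta_0=0$, where $\beta_0$ is a uniformiser of $K$ and either $\alpha=0$ or $0<\omega(\beta_0)\le\omega(\alpha)\le\omega(2)$. Let $i_0$ be the integer such that, for a uniformiser $\pi_K$ of $K$, $\omega(\pi_K^{i_0})=\omega(2)$ if $\alpha=0$ and $\omega(\pi_K^{i_0})=\omega(\alpha)$ if $\alpha\neq0$; it depends only on $L/K$. Let $t$ be a uniformiser of $L$ and $\beta=t\bar t$. Then $x\mapsto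 (x+\bar x)/\beta^{i_0}$ maps $\mathcal O_L$ to $\mathcal O_K$; for an $\mathcal O_K$-algebra $R$ write $\frac{Tr}{\beta^{i_0}}\colon R\otimes_{\mathcal O_K}\mathcal O_L\to R$ for its $R$-linear extension. Write $x\mapsto\bar x$ also for the $R$-linear extension of the conjugation to $R\otimes_{\mathcal O_K}\mathcal O_L$, and $N(x)=x\bar x\in R\subset R\otimes_{\mathcal O_K}\mathcal O_L$. Let $\mathcal R$ be the Weil restriction of $\mathrm{SL}_3$ from $\mathcal O_L$ to $\mathcal O_K$, so that $\mathcal R(R)=\mathrm{SL}_3(R\otimes_{\mathcal O_K}\mathcal O_L)$. Let $$\varphi_{i_0}\colon \mathrm{SU}_3^{L/K}\to\mathcal R_K,\qquad g\mapsto\begin{pmatrix} g_{11}&t^{i_0}g_{12}&g_{13}\\ t^{-i_0}g_{21}&g_{22}&t^{-i_0}g_{23}\\ g_{31}&t^{i_0}g_{32}&g_{33}\end{pmatrix},$$ and let $\underline{\mathrm{SU}}_3^{L/K}$ be the schematic adherence (schematic closure) of $\varphi_{i_0}(\mathrm{SU}_3^{L/K})$ in $\mathcal R$: the closed subscheme of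 $\mathcal R$ defined by the preimage, under $\mathcal O_K[\mathcal R]\to K\otimes_{\mathcal O_K}\mathcal O_K[\mathcal R]$, of the ideal that defines $\varphi_{i_0}(\mathrm{SU}_3^{L/K})$ in $\mathcal R_K$. **Theorem.** With $D=\mathrm{diag}(1,\beta^{i_0},1)$, for every $\mathcal O_K$-algebra $R$, $$\underline{\mathrm{SU}}_3^{L/K}(R)=\Bigl\{g\in\mathrm{SL}_3(R\otimes_{\mathcal O_K}\mathcal O_L)\ \Big|\ {}^{S}\bar g\,D\,g=D,\ \ \tfrac{Tr}{\beta^{i_0}}(\bar g_{31}g_{11})=-N(g_{21}),\ \ \tfrac{Tr}{\beta^{i_0}}(\bar g_{33}g_{13})=-N(g_{23})\Bigr\}.$$ Furthermore, $\underline{\mathrm{SU}}_3^{L/K}$ is smooth over $\mathcal O_K$. -/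

import Mathlib

open scoped TensorProduct ValuativeRel

universe u v w

set_option linter.unusedSectionVars false

noncomputable section

namespace SUModel

section WeilRestriction

variable (A : Type u) (B : Type v) [CommRing A] [CommRing B] [Algebra A B]
  [Module.Free A B] [Module.Finite A B]

/-- Polynomials in the coordinates `x_{ijk}` of a `3 × 3` matrix with entries in `B`, with respect to
an `A`-basis `(b_k)` of the finite free `A`-algebra `B`. -/
abbrev MatrixPoly : Type (max u v) :=
  MvPolynomial (Fin 3 × Fin 3 × Module.Free.ChooseBasisIndex A B) A

/-- The generic matrix, with entries `∑ k, x_{ijk} ⊗ b_k`. -/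
def genericMatrix : Matrix (Fin 3) (Fin 3) (MatrixPoly A B ⊗[A] B) :=
  Matrix.of fun i j => ∑ k, MvPolynomial.X (i, j, k) ⊗ₜ[A] Module.Free.chooseBasis A B k

variable {A B} in
/-- The coordinates in `R` of an element of `R ⊗[A] B` with respect to the basis `(b_k)`. -/
def coord {R : Type w} [CommRing R] [Algebra A R] (x : R ⊗[A] B)
    (k : Module.Free.ChooseBasisIndex A B) : R :=
  (Algebra.TensorProduct.basis R (Module.Free.chooseBasis A B)).repr x k

/-- The ideal generated by the coordinates of the equation `det = 1`. -/
def detIdeal : Ideal (MatrixPoly A B) :=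
  Ideal.span (Set.range fun k => coord ((genericMatrix A B).det - 1) k)

/-- The coordinate ring of the Weil restriction of `SL₃` from `B` to `A`; that it represents the
functor `R ↦ SL₃(R ⊗[A] B)` is `pointsEquiv` below. -/
def CoordRing : Type (max u v) := MatrixPoly A B ⧸ detIdeal A B

instance : CommRing (CoordRing A B) := inferInstanceAs (CommRing (MatrixPoly A B ⧸ detIdeal A B))

instance : Algebra A (CoordRing A B) := inferInstanceAs (Algebra A (MatrixPoly A B ⧸ detIdeal A B))

/-- The projection from the polynomial ring. -/
def CoordRing.mk : MatrixPoly A B →ₐ[A] CoordRing A B := Ideal.Quotient.mkₐ A (detIdeal A B)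

variable {A B}
variable {R : Type w} [CommRing R] [Algebra A R]

lemma coord_map {S : Type*} [CommRing S] [Algebra A S] (f : S →ₐ[A] R) (x : S ⊗[A] B)
    (k : Module.Free.ChooseBasisIndex A B) :
    coord (Algebra.TensorProduct.map f (AlgHom.id A B) x) k = f (coord x k) := by
  induction x with
  | zero => simp [coord]
  | add x y hx hy => simp only [coord, map_add, Finsupp.add_apply] at *; rw [hx, hy]
  | tmul s b => simp [coord]

lemma coord_ext {x y : R ⊗[A] B} (h : ∀ k, coord x k = coord y k) : x = y :=
  (Algebra.TensorProduct.basis R (Module.Free.chooseBasis A B)).repr.injective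
    (Finsupp.ext h)

lemma sum_coord (x : R ⊗[A] B) :
    ∑ k, coord x k ⊗ₜ[A] Module.Free.chooseBasis A B k = x := by
  conv_rhs => rw [← (Algebra.TensorProduct.basis R (Module.Free.chooseBasis A B)).sum_repr x]
  simp [coord, TensorProduct.smul_tmul']

lemma coord_sum (c : Module.Free.ChooseBasisIndex A B → R)
    (k : Module.Free.ChooseBasisIndex A B) :
    coord (∑ l, c l ⊗ₜ[A] Module.Free.chooseBasis A B l) k = c k := by
  classical
  simp [coord, Finsupp.single_apply]

/-- Evaluation of polynomials at the coordinates of a matrix. -/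
def coordHom (g : Matrix (Fin 3) (Fin 3) (R ⊗[A] B)) : MatrixPoly A B →ₐ[A] R :=
  MvPolynomial.aeval fun x => coord (g x.1 x.2.1) x.2.2

lemma map_genericMatrix (g : Matrix (Fin 3) (Fin 3) (R ⊗[A] B)) :
    (genericMatrix A B).map (Algebra.TensorProduct.map (coordHom g) (AlgHom.id A B)) = g := by
  ext i j
  simp [genericMatrix, coordHom, sum_coord]

/-- The algebra homomorphism `CoordRing A B → R` given by a point of `SL₃(R ⊗[A] B)`. -/
def classify (g : Matrix.SpecialLinearGroup (Fin 3) (R ⊗[A] B)) : CoordRing A B →ₐ[A] R :=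
  Ideal.Quotient.liftₐ (detIdeal A B) (coordHom g.1) (by
    intro a ha
    refine (Ideal.span_le (I := RingHom.ker (coordHom g.1))).2 ?_ ha
    rintro _ ⟨k, rfl⟩
    simp only [SetLike.mem_coe, RingHom.mem_ker]
    rw [← coord_map, map_sub, map_one, AlgHom.map_det, AlgHom.mapMatrix_apply,
      map_genericMatrix, g.2, sub_self]
    simp [coord])

lemma classify_mk (g : Matrix.SpecialLinearGroup (Fin 3) (R ⊗[A] B)) (p : MatrixPoly A B) :
    classify g (CoordRing.mk A B p) = coordHom g.1 p := rfl

/-- The universal point. -/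
def universalMatrix : Matrix (Fin 3) (Fin 3) (CoordRing A B ⊗[A] B) :=
  (genericMatrix A B).map
    (Algebra.TensorProduct.map (CoordRing.mk A B) (AlgHom.id A B))

lemma det_universalMatrix : (universalMatrix (A := A) (B := B)).det = 1 := by
  rw [← sub_eq_zero]
  refine coord_ext fun k => ?_
  rw [universalMatrix, ← AlgHom.mapMatrix_apply, ← AlgHom.map_det,
    ← map_one (Algebra.TensorProduct.map (CoordRing.mk A B) (AlgHom.id A B)),
    ← map_sub, coord_map]
  have : coord ((genericMatrix A B).det - 1) k ∈ detIdeal A B := Ideal.subset_span ⟨k, rfl⟩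
  rw [show CoordRing.mk A B _ = 0 from Ideal.Quotient.eq_zero_iff_mem.2 this]
  simp [coord]

/-- The Weil restriction of `SL₃` from `B` to `A`: an `R`-point of the spectrum of `CoordRing A B` is
an element of `SL₃(R ⊗[A] B)`. -/
def pointsEquiv : (CoordRing A B →ₐ[A] R) ≃ Matrix.SpecialLinearGroup (Fin 3) (R ⊗[A] B) where
  toFun f := ⟨universalMatrix.map (Algebra.TensorProduct.map f (AlgHom.id A B)), by
    rw [← AlgHom.mapMatrix_apply]
    exact (AlgHom.map_det (Algebra.TensorProduct.map f (AlgHom.id A B))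
      (universalMatrix (A := A) (B := B))).symm.trans
      (by rw [det_universalMatrix, map_one])⟩
  invFun g := classify g
  left_inv f := by
    refine Ideal.Quotient.algHom_ext _ (MvPolynomial.algHom_ext ?_)
    rintro ⟨i, j, k⟩
    refine (classify_mk _ (MvPolynomial.X (i, j, k))).trans ?_
    change _ = f (CoordRing.mk A B (MvPolynomial.X (i, j, k)))
    simp [coordHom, universalMatrix, genericMatrix, coord_sum]
  right_inv g := by
    ext i j
    simp only [universalMatrix, genericMatrix, Matrix.map_apply, Matrix.of_apply, map_sum,
      Algebra.TensorProduct.map_tmul, classify_mk]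
    simp [coordHom, sum_coord]

end WeilRestriction

section Arithmetic

lemma algebraMap_inj {A : Type*} (K : Type*) {L : Type*} [CommRing A] [Field K] [Algebra A K]
    [IsFractionRing A K] [Field L] [Algebra K L] [Algebra A L] [IsScalarTower A K L] :
    Function.Injective (algebraMap A L) := by
  rw [IsScalarTower.algebraMap_eq A K L]
  exact (algebraMap K L).injective.comp (IsFractionRing.injective A K)

variable (A : Type*) (K : Type*) (L : Type*) [CommRing A] [IsDomain A] [IsDiscreteValuationRing A]
  [Field K] [Algebra A K] [IsFractionRing A K] [Field L] [Algebra K L] [Algebra A L]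
  [IsScalarTower A K L]

/-- The normal form `L = K[s]`, `s² - α s + β = 0` of a ramified separable quadratic extension: `β` is
a uniformiser of `K`, and `α = 0` or `0 < ω(β) ≤ ω(α) ≤ ω(2)`. The inequalities between valuations
are divisibilities in the discrete valuation ring `A` of `K`. -/
structure IsGoodForm (s : L) (α β : A) : Prop where
  adjoin_eq_top : Algebra.adjoin K {s} = ⊤
  root : s ^ 2 - algebraMap A L α * s + algebraMap A L β = 0
  uniformiser : Irreducible β
  bounds : α = 0 ∨ (α ≠ 0 ∧ β ∣ α ∧ α ∣ 2)

open scoped Classical in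
/-- The parameter `i₀` of `L/K`: for a normal form `s² - α s + β = 0` as above, `ω(π_K ^ i₀)` is
`ω(2)` if `α = 0`, and `ω(α)` if `α ≠ 0`. All normal forms give the same number, and there is one
for every ramified `L/K` (`exists_isGoodForm`), so that the infimum is taken over one number. -/
def ramificationParameter : ℕ :=
  sInf {n | ∃ (s : L) (α β : A), IsGoodForm A K L s α β ∧
    IsDiscreteValuationRing.addVal A (if α = 0 then 2 else α) = n}

/-- A quadratic extension with rings of integers `A ⊆ B` is ramified if `𝔪_A B` is the square of a
prime ideal of `B`. -/
def IsRamified (B : Type*) [CommRing B] [Algebra A B] : Prop :=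
  ∃ P : Ideal B, P.IsPrime ∧ (IsLocalRing.maximalIdeal A).map (algebraMap A B) = P ^ 2

variable {A K L}

lemma descend {x : L} (hx : IsIntegral A x) (hK : x ∈ Set.range (algebraMap K L)) :
    ∃ a : A, algebraMap A L a = x := by
  obtain ⟨y, rfl⟩ := hK
  have : IsIntegral A y := (isIntegral_algebraMap_iff (algebraMap K L).injective).1 hx
  obtain ⟨a, rfl⟩ := IsIntegrallyClosed.isIntegral_iff.1 this
  exact ⟨a, IsScalarTower.algebraMap_apply A K L a⟩

lemma dvd_descend {A : Type*} (K : Type*) {L : Type*} [CommRing A] [IsDomain A]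
    [IsDiscreteValuationRing A] [Field K] [Algebra A K] [IsFractionRing A K] [Field L] [Algebra K L]
    [Algebra A L] [IsScalarTower A K L] {a b : A} {w : L} (hw : IsIntegral A w)
    (h : algebraMap A L a * w = algebraMap A L b) : a ∣ b := by
  have inj := algebraMap_inj (A := A) K (L := L)
  by_cases ha : a = 0
  · subst ha
    rw [map_zero, zero_mul] at h
    rw [inj (h.symm.trans (map_zero _).symm)]
  · have ha' : algebraMap A L a ≠ 0 := fun h0 => ha (inj (h0.trans (map_zero _).symm))
    obtain ⟨c, hc⟩ := descend (K := K) hw ⟨algebraMap A K b / algebraMap A K a, by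
      rw [map_div₀, ← IsScalarTower.algebraMap_apply A K L, ← IsScalarTower.algebraMap_apply A K L,
        ← h, mul_div_cancel_left₀ _ ha']⟩
    exact ⟨c, inj (by rw [map_mul, hc, h])⟩

lemma exists_coords {s : L} {α β : A} (h : IsGoodForm A K L s α β) (x : L) :
    ∃ p q : K, x = algebraMap K L p + algebraMap K L q * s := by
  have hx : x ∈ Algebra.adjoin K {s} := h.adjoin_eq_top ▸ Algebra.mem_top
  induction hx using Algebra.adjoin_induction with
  | mem x hx => exact ⟨0, 1, by simp [Set.mem_singleton_iff.1 hx]⟩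
  | algebraMap r => exact ⟨r, 0, by simp⟩
  | add x y _ _ hx hy =>
    obtain ⟨p, q, rfl⟩ := hx
    obtain ⟨p', q', rfl⟩ := hy
    exact ⟨p + p', q + q', by simp only [map_add]; ring⟩
  | mul x y _ _ hx hy =>
    obtain ⟨p, q, rfl⟩ := hx
    obtain ⟨p', q', rfl⟩ := hy
    refine ⟨p * p' - q * q' * algebraMap A K β, p * q' + q * p' + q * q' * algebraMap A K α, ?_⟩
    have := h.root
    simp only [map_add, map_sub, map_mul, ← IsScalarTower.algebraMap_apply A K L]
    linear_combination (algebraMap K L q * algebraMap K L q') * this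

lemma conj_root {s : L} {α β : A} (h : IsGoodForm A K L s α β) {σ : L ≃ₐ[K] L} (hσ : σ ≠ 1) :
    σ s = algebraMap A L α - s := by
  have hA (a : A) : σ (algebraMap A L a) = algebraMap A L a := by
    rw [IsScalarTower.algebraMap_apply A K L, σ.commutes]
  have hne : σ s ≠ s := by
    intro hs
    apply hσ
    ext x
    obtain ⟨p, q, rfl⟩ := exists_coords h x
    simp [hs]
  have h1 := congrArg σ h.root
  simp only [map_add, map_sub, map_mul, map_pow, hA, map_zero] at h1
  have : (σ s - s) * (σ s - (algebraMap A L α - s)) = 0 := by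
    linear_combination h1 - h.root
  rcases mul_eq_zero.1 this with h2 | h2
  · exact absurd (sub_eq_zero.1 h2) hne
  · exact sub_eq_zero.1 h2

lemma integral_root {s : L} {α β : A} (h : IsGoodForm A K L s α β) : IsIntegral A s := by
  refine ⟨Polynomial.X ^ 2 - Polynomial.C α * Polynomial.X + Polynomial.C β, ?_, ?_⟩
  · monicity!
  · simpa [Polynomial.eval₂_add] using h.root

lemma dvd_coords {s : L} {α β : A} (h : IsGoodForm A K L s α β) {σ : L ≃ₐ[K] L} (hσ : σ ≠ 1)
    {y z : A} {w : L} (hw : IsIntegral A w)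
    (hyz : algebraMap A L β * w = algebraMap A L y + algebraMap A L z * s) : β ∣ y ∧ β ∣ z := by
  have inj := algebraMap_inj (A := A) K (L := L)
  have hA (a : A) : σ (algebraMap A L a) = algebraMap A L a := by
    rw [IsScalarTower.algebraMap_apply A K L, σ.commutes]
  have hσi {x : L} (hx : IsIntegral A x) : IsIntegral A (σ x) :=
    hx.map ((σ : L →ₐ[K] L).restrictScalars A)
  have hs := conj_root h hσ
  have hi := integral_root h
  have hi' : IsIntegral A (σ s) := hσi hi
  have hp : Prime β := h.uniformiser.prime
  have hβ0 : algebraMap A L β ≠ 0 := fun h0 => hp.ne_zero (inj (h0.trans (map_zero _).symm))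
  have hss : s * σ s = algebraMap A L β := by
    rw [hs]; linear_combination -h.root
  have hs0 : s ≠ 0 := by rintro rfl; exact hβ0 (by rw [← hss, zero_mul])
  have key : ∀ (c : A) (r m : L), IsIntegral A m → r * σ r = algebraMap A L β →
      algebraMap A L c = r * m → β ∣ c := by
    intro c r m hm hr hc
    have hc' := congrArg σ hc
    rw [hA, map_mul] at hc'
    refine hp.dvd_of_dvd_pow (n := 2) (dvd_descend K (hm.mul (hσi hm)) ?_)
    rw [map_pow, pow_two, ← hr]
    nth_rewrite 1 [hc]
    rw [hc']
    ring
  have h1 : β ∣ y := by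
    refine key y s (σ s * w - algebraMap A L z) ((hi'.mul hw).sub isIntegral_algebraMap) hss ?_
    linear_combination -hyz - w * hss
  refine ⟨h1, ?_⟩
  obtain ⟨y', rfl⟩ := h1
  have hss' : σ s * σ (σ s) = algebraMap A L β := by rw [← map_mul, hss, hA]
  refine key z (σ s) (w - algebraMap A L y') (hw.sub isIntegral_algebraMap) hss' ?_
  apply mul_right_cancel₀ hs0
  rw [map_mul] at hyz
  linear_combination -hyz - (w - algebraMap A L y') * hss

lemma exists_int_coords {s : L} {α β : A} (h : IsGoodForm A K L s α β) {σ : L ≃ₐ[K] L}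
    (hσ : σ ≠ 1) {x : L} (hx : IsIntegral A x) :
    ∃ p q : A, x = algebraMap A L p + algebraMap A L q * s := by
  have inj := algebraMap_inj (A := A) K (L := L)
  have hβ0 : algebraMap A L β ≠ 0 := fun h0 =>
    h.uniformiser.ne_zero (inj (h0.trans (map_zero _).symm))
  have main : ∀ (n : ℕ) (p q : A),
      algebraMap A L β ^ n * x = algebraMap A L p + algebraMap A L q * s →
      ∃ p q : A, x = algebraMap A L p + algebraMap A L q * s := by
    intro n
    induction n with
    | zero => intro p q hpq; exact ⟨p, q, by simpa using hpq⟩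
    | succ n ih =>
      intro p q hpq
      have hw : IsIntegral A (algebraMap A L β ^ n * x) := (isIntegral_algebraMap.pow n).mul hx
      obtain ⟨⟨p', rfl⟩, ⟨q', rfl⟩⟩ := dvd_coords h hσ hw (y := p) (z := q)
        (by rw [← hpq]; ring)
      refine ih p' q' (mul_left_cancel₀ hβ0 ?_)
      simp only [map_mul] at hpq
      linear_combination hpq
  obtain ⟨p, q, hpq⟩ := exists_coords h x
  classical
  obtain ⟨d, hd⟩ := IsLocalization.exist_integer_multiples_of_finset (nonZeroDivisors A)
    (insert p (singleton q) : Finset K)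
  obtain ⟨p', hp'⟩ := hd p (by simp)
  obtain ⟨q', hq'⟩ := hd q (by simp)
  obtain ⟨n, u, hu⟩ := IsDiscreteValuationRing.eq_unit_mul_pow_irreducible
    (nonZeroDivisors.coe_ne_zero d) h.uniformiser
  refine main n (↑u⁻¹ * p') (↑u⁻¹ * q') ?_
  have hun : algebraMap A L ↑u⁻¹ * algebraMap A L ↑u = 1 := by
    rw [← map_mul, Units.inv_mul, map_one]
  have e (r : K) (r' : A) (hr : algebraMap A K r' = (d : A) • r) :
      algebraMap A L r' = algebraMap A L ↑u * algebraMap A L β ^ n * algebraMap K L r := by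
    rw [IsScalarTower.algebraMap_apply A K L, hr, Algebra.smul_def, map_mul,
      ← IsScalarTower.algebraMap_apply A K L, hu, map_mul, map_pow]
  rw [hpq, map_mul, map_mul, e p p' hp', e q q' hq']
  linear_combination (-algebraMap A L β ^ n * (algebraMap K L p + algebraMap K L q * s)) * hun

section Galois

variable [Algebra.IsQuadraticExtension K L] [Algebra.IsSeparable K L]

lemma fixed_mem {σ : L ≃ₐ[K] L} (hσ : σ ≠ 1) {x : L} (hx : σ x = x) :
    x ∈ Set.range (algebraMap K L) := by
  have hcard : Nat.card (L ≃ₐ[K] L) = 2 := by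
    rw [IsGalois.card_aut_eq_finrank, Algebra.IsQuadraticExtension.finrank_eq_two]
  obtain ⟨y, hy, huniq⟩ := (Nat.card_eq_two_iff' (1 : L ≃ₐ[K] L)).1 hcard
  refine (IsGalois.mem_range_algebraMap_iff_fixed x).2 fun g => ?_
  by_cases hg : g = 1
  · simp [hg]
  · rw [huniq g hg, ← huniq σ hσ, hx]

lemma conj_conj (σ : L ≃ₐ[K] L) (x : L) : σ (σ x) = x := by
  have hcard : Nat.card (L ≃ₐ[K] L) = 2 := by
    rw [IsGalois.card_aut_eq_finrank, Algebra.IsQuadraticExtension.finrank_eq_two]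
  have : σ ^ 2 = 1 := by rw [← hcard]; exact pow_card_eq_one'
  simpa [pow_two] using congrArg (fun g : L ≃ₐ[K] L => g x) this

variable {B : Type*} [CommRing B] [Algebra A B] [Algebra B L] [IsScalarTower A B L]
  [IsIntegralClosure B A L]

lemma isDVR_of_ramified (K L : Type*) 
  [Field K] [Algebra A K] [IsFractionRing A K] [Field L] [Algebra K L] [Algebra A L]
  [IsScalarTower A K L] [Algebra.IsQuadraticExtension K L] [Algebra.IsSeparable K L]
  [Algebra B L] [IsScalarTower A B L]
  [IsIntegralClosure B A L]
  [IsDomain B] (hram : IsRamified A B) : ∃ (_ : IsDiscreteValuationRing B),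
    (IsLocalRing.maximalIdeal A).map (algebraMap A B) = IsLocalRing.maximalIdeal B ^ 2 := by
  have this_d : IsDedekindDomain B := IsIntegralClosure.isDedekindDomain A K L B
  have injB : Function.Injective (algebraMap A B) := by
    have := algebraMap_inj (A := A) K (L := L)
    rw [IsScalarTower.algebraMap_eq A B L] at this
    exact Function.Injective.of_comp this
  have : Algebra.IsIntegral A B := IsIntegralClosure.isIntegral_algebra A L
  obtain ⟨P, hP, h⟩ := hram
  obtain ⟨ϖ, hϖ⟩ := IsDiscreteValuationRing.exists_irreducible A
  have hP0 : P ≠ ⊥ := by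
    rintro rfl
    rw [← Ideal.zero_eq_bot, zero_pow two_ne_zero, Ideal.zero_eq_bot, Ideal.map_eq_bot_iff_of_injective injB] at h
    exact IsDiscreteValuationRing.not_a_field A h
  have hPm : P.IsMaximal := hP.isMaximal hP0
  have huniq : ∀ M : Ideal B, M.IsMaximal → M = P := by
    intro M hM
    have h1 : M.under A = IsLocalRing.maximalIdeal A :=
      IsLocalRing.eq_maximalIdeal (Ideal.isMaximal_comap_of_isIntegral_of_isMaximal M)
    have h2 : P ^ 2 ≤ M := by
      rw [← h, ← h1]; exact Ideal.map_comap_le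
    exact (hPm.eq_of_le hM.ne_top (hM.isPrime.le_of_pow_le h2)).symm
  have : IsLocalRing B := IsLocalRing.of_unique_max_ideal ⟨P, hPm, huniq⟩
  have hPe : P = IsLocalRing.maximalIdeal B := IsLocalRing.eq_maximalIdeal hPm
  have hnf : ¬ IsField B := fun hf => hP0 (by
    have := IsLocalRing.isField_iff_maximalIdeal_eq.1 hf
    rw [hPe, this])
  have hD : IsDiscreteValuationRing B :=
    ((IsDiscreteValuationRing.TFAE B hnf).out 0 2 rfl rfl).2 this_d
  exact ⟨hD, by rw [h, hPe]⟩

lemma exists_norm (σ : L ≃ₐ[K] L) (hσ : σ ≠ 1) (hram : IsRamified A B) {t : B}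
    (ht : Irreducible t) : ∃ b : A, Irreducible b ∧ algebraMap A L b =
      algebraMap B L t * σ (algebraMap B L t) := by
  have injB : Function.Injective (algebraMap B L) := IsIntegralClosure.algebraMap_injective B A L
  have : IsDomain B := injB.isDomain
  obtain ⟨hD, h⟩ := isDVR_of_ramified K L hram
  obtain ⟨ϖ, hϖ⟩ := IsDiscreteValuationRing.exists_irreducible A
  have : Algebra.IsAlgebraic K L := inferInstance
  set τ := galRestrict A K L B σ with hτ
  have hτt : algebraMap B L (τ t) = σ (algebraMap B L t) := algebraMap_galRestrict_apply A σ t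
  have hint (x : B) : IsIntegral A (algebraMap B L x) := IsIntegralClosure.isIntegral A L x |>.algebraMap
  obtain ⟨b, hb⟩ := descend (A := A) (K := K) (x := algebraMap B L (t * τ t)) (hint _)
    (fixed_mem hσ (by rw [map_mul, hτt, map_mul, conj_conj σ, mul_comm]))
  refine ⟨b, ?_, by rw [hb, map_mul, hτt]⟩
  have hτirr : Irreducible (τ t) := (MulEquiv.irreducible_iff (τ : B ≃* B)).2 ht
  have h1 : Associated (t * τ t) (t ^ 2) := by
    rw [pow_two]
    exact (IsDiscreteValuationRing.associated_of_irreducible B ht hτirr).symm.mul_left t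
  have h2 : Associated (algebraMap A B ϖ) (t ^ 2) := by
    rw [hϖ.maximalIdeal_eq, ht.maximalIdeal_eq, Ideal.map_span, Set.image_singleton,
      Ideal.span_singleton_pow, Ideal.span_singleton_eq_span_singleton] at h
    exact h
  have h3 := h1.trans h2.symm
  have hbϖ : Associated b ϖ := by
    refine associated_of_dvd_dvd ?_ ?_
    · obtain ⟨c, hc⟩ := h3.dvd
      refine dvd_descend K (hint c) ?_
      rw [hb, ← map_mul, ← hc, ← IsScalarTower.algebraMap_apply]
    · obtain ⟨c, hc⟩ := h3.symm.dvd
      refine dvd_descend K (hint c) ?_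
      rw [hb, hc, map_mul, ← IsScalarTower.algebraMap_apply]
  exact hbϖ.symm.irreducible hϖ

/-- A ramified separable quadratic extension has a normal form. -/
theorem exists_isGoodForm (σ : L ≃ₐ[K] L) (hσ : σ ≠ 1) (hram : IsRamified A B) :
    ∃ (s : L) (α β : A), IsGoodForm A K L s α β := by
  have injA := algebraMap_inj (A := A) K (L := L)
  have injB : Function.Injective (algebraMap B L) := IsIntegralClosure.algebraMap_injective B A L
  have : IsDomain B := injB.isDomain
  obtain ⟨hD, h⟩ := isDVR_of_ramified K L hram
  have : Algebra.IsAlgebraic K L := inferInstance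
  obtain ⟨t, ht⟩ := IsDiscreteValuationRing.exists_irreducible B
  obtain ⟨b, hb, hbt⟩ := exists_norm σ hσ hram ht
  have hint (x : B) : IsIntegral A (algebraMap B L x) := IsIntegralClosure.isIntegral A L x |>.algebraMap
  have hA (a : A) : σ (algebraMap A L a) = algebraMap A L a := by
    rw [IsScalarTower.algebraMap_apply A K L, σ.commutes]
  have hti : IsIntegral A (σ (algebraMap B L t)) :=
    (hint t).map ((σ : L →ₐ[K] L).restrictScalars A)
  set s := algebraMap B L t with hs
  obtain ⟨a, ha⟩ := descend (A := A) (K := K) (x := s + σ s) ((hint t).add hti)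
    (fixed_mem hσ (by rw [map_add, conj_conj σ, add_comm]))
  have hroot : s ^ 2 - algebraMap A L a * s + algebraMap A L b = 0 := by
    rw [ha, hbt]; ring
  have htop : ∀ c : A, Algebra.adjoin K {s - algebraMap A L c} = ⊤ := by
    intro c
    have hsK : s ∉ Set.range (algebraMap K L) := by
      intro hsK
      obtain ⟨d, hd⟩ := descend (A := A) (K := K) (hint t) hsK
      have : b = d * d := injA (by rw [hbt, hs, ← hd, hA, map_mul])
      rw [this] at hb
      exact hb.not_isSquare ⟨d, rfl⟩
    have : IsSimpleOrder (Subalgebra K L) := Subalgebra.isSimpleOrder_of_finrank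
      (Algebra.IsQuadraticExtension.finrank_eq_two K L)
    refine (eq_bot_or_eq_top _).resolve_left fun hbot => hsK ?_
    have hm : s - algebraMap A L c ∈ (⊥ : Subalgebra K L) := hbot ▸ Algebra.subset_adjoin rfl
    obtain ⟨k, hk⟩ := Algebra.mem_bot.1 hm
    refine ⟨k + algebraMap A K c, ?_⟩
    rw [map_add, hk, ← IsScalarTower.algebraMap_apply]; ring
  have hba : b ∣ a := by
    have : a ∈ IsLocalRing.maximalIdeal A := by
      rw [IsLocalRing.mem_maximalIdeal, mem_nonunits_iff]
      intro hu
      have h1 : algebraMap A B a = t + galRestrict A K L B σ t := injB (by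
        rw [← IsScalarTower.algebraMap_apply, ha, map_add, algebraMap_galRestrict_apply])
      have ht1 : t ∈ IsLocalRing.maximalIdeal B := ht.not_isUnit
      have ht2 : galRestrict A K L B σ t ∈ IsLocalRing.maximalIdeal B := by
        rw [IsLocalRing.mem_maximalIdeal, mem_nonunits_iff, MulEquiv.isUnit_map]
        exact ht.not_isUnit
      exact ((IsLocalRing.mem_maximalIdeal _).1 (h1 ▸ add_mem ht1 ht2)) (hu.map _)
    rwa [hb.maximalIdeal_eq, Ideal.mem_span_singleton] at this
  by_cases ha0 : a = 0
  · exact ⟨s, a, b, by simpa using htop 0, hroot, hb, Or.inl ha0⟩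
  by_cases ha2 : a ∣ 2
  · exact ⟨s, a, b, by simpa using htop 0, hroot, hb, Or.inr ⟨ha0, hba, ha2⟩⟩
  obtain ⟨c, hc⟩ := (ValuationRing.dvd_total a 2).resolve_left ha2
  have hbc : b ∣ c := by
    have : c ∈ IsLocalRing.maximalIdeal A := by
      rw [IsLocalRing.mem_maximalIdeal, mem_nonunits_iff]
      rintro ⟨u, rfl⟩
      exact ha2 ⟨↑u⁻¹, by rw [hc, mul_assoc, Units.mul_inv, mul_one]⟩
    rwa [hb.maximalIdeal_eq, Ideal.mem_span_singleton] at this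
  refine ⟨s - algebraMap A L c, 0, b - c ^ 2, htop c, ?_, ?_, Or.inl rfl⟩
  · rw [hc] at hroot
    simp only [map_mul, map_ofNat, map_sub, map_pow, map_zero] at hroot ⊢
    linear_combination hroot
  · obtain ⟨d, hd⟩ := hbc
    have hu : IsUnit (1 - c * d) := by
      have : c * d ∈ IsLocalRing.maximalIdeal A := by
        rw [hb.maximalIdeal_eq, Ideal.mem_span_singleton, hd, mul_assoc]
        exact dvd_mul_right _ _
      by_contra hcon
      have h1 := add_mem ((IsLocalRing.mem_maximalIdeal _).2 hcon) this
      rw [sub_add_cancel] at h1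
      exact h1 isUnit_one
    have : b - c ^ 2 = b * (1 - c * d) := by
      linear_combination -c * hd
    rw [this]
    exact (irreducible_mul_isUnit hu).2 hb

open scoped Classical in
lemma parameter_spec (σ : L ≃ₐ[K] L) (hσ : σ ≠ 1) (hram : IsRamified A B) :
    ∃ (s : L) (α β : A), IsGoodForm A K L s α β ∧
    IsDiscreteValuationRing.addVal A (if α = 0 then 2 else α) = ramificationParameter A K L := by
  refine Nat.sInf_mem (s := {n : ℕ | ∃ (s : L) (α β : A), IsGoodForm A K L s α β ∧
    IsDiscreteValuationRing.addVal A (if α = 0 then 2 else α) = n}) ?_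
  obtain ⟨s, α, β, h⟩ := exists_isGoodForm σ hσ hram
  have hne : (if α = 0 then 2 else α) ≠ 0 := by
    split_ifs with h0
    · intro h2
      subst h0
      have h3 := conj_root h hσ
      have h4 : (2 : L) = 0 := by
        rw [← map_ofNat (algebraMap A L) 2, h2, map_zero]
      have hid : σ s = s := by
        rw [h3, map_zero]; linear_combination (-s) * h4
      apply hσ
      ext x
      obtain ⟨p, q, rfl⟩ := exists_coords h x
      simp [hid]
    · exact h0
  have := (IsDiscreteValuationRing.addVal_eq_top_iff (R := A)).not.2 hne
  obtain ⟨n, hn⟩ := ENat.ne_top_iff_exists.1 this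
  exact ⟨n, s, α, β, h, hn.symm⟩

/-- Traces of elements of `B` are divisible by `(t t̄) ^ i₀`, and the quotient is an `A`-linear map
`B → A`. -/
theorem exists_reducedTrace (σ : L ≃ₐ[K] L) (hσ : σ ≠ 1) (hram : IsRamified A B) {t : B}
    (ht : Irreducible t) : ∃ T : B →ₗ[A] A, ∀ x : B,
      algebraMap A B (T x) * (t * galRestrict A K L B σ t) ^ ramificationParameter A K L =
        x + galRestrict A K L B σ x := by
  classical
  have injA := algebraMap_inj (A := A) K (L := L)
  have injB : Function.Injective (algebraMap B L) := IsIntegralClosure.algebraMap_injective B A L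
  have hint (x : B) : IsIntegral A (algebraMap B L x) := IsIntegralClosure.isIntegral A L x |>.algebraMap
  have hA (a : A) : σ (algebraMap A L a) = algebraMap A L a := by
    rw [IsScalarTower.algebraMap_apply A K L, σ.commutes]
  obtain ⟨b, hb, hbt⟩ := exists_norm σ hσ hram ht
  obtain ⟨s, α, β, h, hn⟩ := parameter_spec σ hσ hram
  set n := ramificationParameter A K L
  have hdvd : b ^ n ∣ (if α = 0 then 2 else α) := by
    rw [← IsDiscreteValuationRing.addVal_le_iff_dvd, hn, hb.addVal_pow]
  have hb0 : algebraMap A L b ^ n ≠ 0 :=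
    pow_ne_zero _ fun h0 => hb.ne_zero (injA (h0.trans (map_zero _).symm))
  have hd2 : (if α = 0 then 2 else α) ∣ 2 := by
    rcases h.bounds with h0 | ⟨h0, -, h2⟩
    · simp [h0]
    · simpa [h0] using h2
  have hdα : (if α = 0 then 2 else α) ∣ α := by
    split_ifs with h0
    · simp [h0]
    · exact dvd_rfl
  have key (x : B) : ∃ c : A, algebraMap A L c * algebraMap A L b ^ n =
      algebraMap B L x + σ (algebraMap B L x) := by
    obtain ⟨p, q, hpq⟩ := exists_int_coords h hσ (hint x)
    obtain ⟨c, hc⟩ : b ^ n ∣ 2 * p + α * q :=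
      dvd_add ((hdvd.trans hd2).mul_right p) ((hdvd.trans hdα).mul_right q)
    refine ⟨c, ?_⟩
    rw [← map_pow, ← map_mul, mul_comm c, ← hc, hpq]
    simp only [map_add, map_mul, hA, conj_root h hσ, map_ofNat]
    ring
  choose T hT using key
  refine ⟨{ toFun := T, map_add' := fun x y => ?_, map_smul' := fun a x => ?_ }, fun x => ?_⟩
  · apply injA
    apply mul_right_cancel₀ hb0
    rw [hT, map_add, map_add, map_add, add_mul, hT, hT]
    ring
  · apply injA
    apply mul_right_cancel₀ hb0
    rw [hT, RingHom.id_apply, smul_eq_mul, map_mul, mul_assoc, hT, Algebra.smul_def, map_mul,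
      map_mul, ← IsScalarTower.algebraMap_apply, hA]
    ring
  · apply injB
    have := hT x
    rw [hbt] at this
    simpa only [map_mul, map_pow, map_add, LinearMap.coe_mk, AddHom.coe_mk,
      algebraMap_galRestrict_apply, ← IsScalarTower.algebraMap_apply] using this

open scoped Classical in
variable (A K) in
/-- The reduced trace `B → A`, `x ↦ (x + x̄) / β ^ i₀`, where `β = t t̄`. -/
def reducedTrace (σ : L ≃ₐ[K] L) (t : B) : B →ₗ[A] A :=
  if h : ∃ T : B →ₗ[A] A, ∀ x : B,
      algebraMap A B (T x) * (t * galRestrict A K L B σ t) ^ ramificationParameter A K L =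
        x + galRestrict A K L B σ x
  then h.choose else 0

theorem reducedTrace_spec (σ : L ≃ₐ[K] L) (hσ : σ ≠ 1) (hram : IsRamified A B) {t : B}
    (ht : Irreducible t) (x : B) :
    algebraMap A B (reducedTrace A K σ t x) *
      (t * galRestrict A K L B σ t) ^ ramificationParameter A K L =
        x + galRestrict A K L B σ x := by
  have h := exists_reducedTrace (A := A) σ hσ hram ht
  rw [reducedTrace, dif_pos h]
  exact h.choose_spec x

end Galois

end Arithmetic
section SpecialUnitary

/-- The transpose along the anti-diagonal. -/
def antiTranspose {S : Type*} (M : Matrix (Fin 3) (Fin 3) S) : Matrix (Fin 3) (Fin 3) S :=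
  Matrix.of fun i j => M (Fin.rev j) (Fin.rev i)

variable {K : Type u} {L : Type u} [Field K] [Field L] [Algebra K L]

/-- The algebraic group `SU₃` of `L/K`, through its functor of points: the points over a `K`-algebra
`S` are the `g ∈ SL₃(S ⊗[K] L)` for which the anti-transpose of `ḡ`, times `g`, is the identity. -/
def SU3 (σ : L ≃ₐ[K] L) (S : Type u) [CommRing S] [Algebra K S] :
    Set (Matrix.SpecialLinearGroup (Fin 3) (S ⊗[K] L)) :=
  {g | antiTranspose (g.1.map (Algebra.TensorProduct.map (AlgHom.id K S) (σ : L →ₐ[K] L))) * g.1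
    = 1}

/-- The twist: the entries `12` and `32` are multiplied by `t ^ i₀`, the entries `21` and `23` by
`t ^ (-i₀)`. -/
def twist (i₀ : ℕ) (t : L) {S : Type u} [CommRing S] [Algebra K S]
    (g : Matrix (Fin 3) (Fin 3) (S ⊗[K] L)) : Matrix (Fin 3) (Fin 3) (S ⊗[K] L) :=
  let p : S ⊗[K] L := 1 ⊗ₜ t ^ i₀
  let q : S ⊗[K] L := 1 ⊗ₜ (t ^ i₀)⁻¹
  !![g 0 0, p * g 0 1, g 0 2;
     q * g 1 0, g 1 1, q * g 1 2;
     g 2 0, p * g 2 1, g 2 2]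

end SpecialUnitary

section Adherence

variable (A : Type u) (K : Type u) (L : Type u) (B : Type u)
  [CommRing A] [Field K] [Algebra A K] [Field L] [Algebra K L] [Algebra A L] [IsScalarTower A K L]
  [CommRing B] [Algebra A B] [Algebra B L] [IsScalarTower A B L]

/-- For a `K`-algebra `S`, the canonical map `S ⊗[A] B → S ⊗[K] L`, `s ⊗ b ↦ s ⊗ b`. If `A` and `B`
are the rings of integers of `K` and `L`, it is an isomorphism, see `toGeneric_bijective`. -/
def toGeneric (S : Type u) [CommRing S] [Algebra K S] [Algebra A S] [IsScalarTower A K S] :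
    S ⊗[A] B →ₐ[A] S ⊗[K] L :=
  Algebra.TensorProduct.lift
    (Algebra.TensorProduct.includeLeft : S →ₐ[A] S ⊗[K] L)
    (((Algebra.TensorProduct.includeRight : L →ₐ[K] S ⊗[K] L).restrictScalars A).comp
      (IsScalarTower.toAlgHom A B L))
    (fun _ _ => mul_comm _ _)

theorem toGeneric_bijective [IsDomain A] [IsFractionRing A K] [IsIntegralClosure B A L]
    [Algebra.IsAlgebraic K L]
    (S : Type u) [CommRing S] [Algebra K S] [Algebra A S] [IsScalarTower A K S] :
    Function.Bijective (toGeneric A K L B S) := by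
  have := IsIntegralClosure.isLocalization A K L B
  have : Algebra.IsPushout A B K L :=
    Algebra.isPushout_of_isLocalization (nonZeroDivisors A) K B L
  let e := (Algebra.TensorProduct.comm A S B).toEquiv.trans
    ((Algebra.IsPushout.cancelBaseChangeAlg A B K L S).symm.toEquiv.trans
      (Algebra.TensorProduct.comm K L S).toEquiv)
  have he : ⇑(toGeneric A K L B S) = ⇑e := by
    funext x
    induction x with
    | zero => simp [e]
    | add x y hx hy => simp only [map_add, hx, hy]; simp [e]
    | tmul s b =>
      refine (Algebra.TensorProduct.lift_tmul _ _ _ _ _).trans ?_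
      simp [e]
  rw [he]
  exact e.bijective

variable [Module.Free A B] [Module.Finite A B]

variable {A B} in
/-- Evaluation of regular functions on the generic fibre of the Weil restriction at a point with
values in a `K`-algebra `S`. -/
def evalGeneric {S : Type u} [CommRing S] [Algebra K S] [Algebra A S] [IsScalarTower A K S]
    (z : Matrix.SpecialLinearGroup (Fin 3) (S ⊗[A] B)) : K ⊗[A] CoordRing A B →ₐ[A] S :=
  Algebra.TensorProduct.lift (IsScalarTower.toAlgHom A K S) (pointsEquiv.symm z)
    (fun _ _ => mul_comm _ _)

variable {K L B}

/-- The ideal, in the coordinate ring `K ⊗[A] CoordRing A B` of the generic fibre of the Weil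
restriction, that defines the twisted `SU₃`: the functions that vanish on all its points, with values
in arbitrary `K`-algebras. -/
def genericIdeal (σ : L ≃ₐ[K] L) (i₀ : ℕ) (t : B) : Ideal (K ⊗[A] CoordRing A B) where
  carrier := {F | ∀ (S : Type u) [CommRing S] [Algebra K S] [Algebra A S] [IsScalarTower A K S],
    ∀ z : Matrix.SpecialLinearGroup (Fin 3) (S ⊗[A] B),
    (∃ g ∈ SU3 σ S, z.1.map (toGeneric A K L B S) = twist i₀ (algebraMap B L t) g.1) →
      evalGeneric K z F = 0}
  zero_mem' := fun S _ _ _ _ z _ => map_zero _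
  add_mem' := fun ha hb S _ _ _ _ z hz => by rw [map_add, ha S z hz, hb S z hz, add_zero]
  smul_mem' := fun c a ha S _ _ _ _ z hz => by rw [smul_eq_mul, map_mul, ha S z hz, mul_zero]

/-- The ideal of the schematic adherence of the twisted `SU₃` in the Weil restriction of `SL₃`: the
preimage in the coordinate ring over `A` of the ideal that defines the twisted `SU₃` over `K`. -/
def adherenceIdeal (σ : L ≃ₐ[K] L) (i₀ : ℕ) (t : B) : Ideal (CoordRing A B) :=
  (genericIdeal A σ i₀ t).comap
    (Algebra.TensorProduct.includeRight : CoordRing A B →ₐ[A] K ⊗[A] CoordRing A B)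

/-- The coordinate ring of the schematic adherence. -/
abbrev AdherenceRing (σ : L ≃ₐ[K] L) (i₀ : ℕ) (t : B) : Type u :=
  CoordRing A B ⧸ adherenceIdeal A σ i₀ t

/-- The `R`-points of the schematic adherence, as a subset of `SL₃(R ⊗[A] B)`. -/
def adherencePoints (σ : L ≃ₐ[K] L) (i₀ : ℕ) (t : B) (R : Type v) [CommRing R] [Algebra A R] :
    Set (Matrix.SpecialLinearGroup (Fin 3) (R ⊗[A] B)) :=
  {g | ∀ F ∈ adherenceIdeal A σ i₀ t, pointsEquiv.symm g F = 0}

end Adherence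

section Equations

variable {A : Type u} {B : Type u} [CommRing A] [CommRing B] [Algebra A B]
  {R : Type v} [CommRing R] [Algebra A R]

/-- The conjugation `r ⊗ x ↦ r ⊗ x̄` of `R ⊗[A] B`. -/
def conj (τ : B ≃ₐ[A] B) : R ⊗[A] B →ₐ[A] R ⊗[A] B :=
  Algebra.TensorProduct.map (AlgHom.id A R) (τ : B →ₐ[A] B)

/-- The base change `R ⊗[A] B → R ⊗[A] A = R`, `r ⊗ x ↦ T(x) r`, of a linear map `T : B → A`. -/
def baseChangeForm (T : B →ₗ[A] A) : R ⊗[A] B →ₗ[A] R :=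
  (TensorProduct.rid A R).toLinearMap ∘ₗ T.lTensor R

/-- The diagonal matrix with entries `1, c, 1`. -/
def hermitianMatrix {S : Type*} [CommRing S] (c : S) : Matrix (Fin 3) (Fin 3) S :=
  Matrix.diagonal ![1, c, 1]

end Equations

section Instances

variable (K L : Type*) [Field K] [ValuativeRel K] [TopologicalSpace K]
  [IsNonarchimedeanLocalField K] [Field L] [Algebra K L] [FiniteDimensional K L]
  [Algebra.IsSeparable K L]

instance finite_integralClosure : Module.Finite 𝒪[K] (integralClosure 𝒪[K] L) :=
  IsIntegralClosure.finite 𝒪[K] K L (integralClosure 𝒪[K] L)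

instance free_integralClosure : Module.Free 𝒪[K] (integralClosure 𝒪[K] L) := by
  have : Module.IsTorsionFree 𝒪[K] L := .trans_faithfulSMul 𝒪[K] K L
  exact IsIntegralClosure.module_free 𝒪[K] K L (integralClosure 𝒪[K] L)

end Instances

end SUModel

end

/-! Write `d = β ^ i₀`, let `h` be the hermitian form with matrix `antidiag(1, d, 1)`, and let `q(x)
= T(x̄₃ x₁) + N(x₂)`, where `T` is the reduced trace. Since `d T(x) = x + x̄`, one has `h(x, x) = d
q(x)`. The unitary equation alone gives only `d q = 0` on the outer columns; the two extra equations
of the model remove the factor `d`.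

Smoothness rests on two facts valid over every base `R`. A point of the model amounts to a pair of
outer columns `x`, `y` with `q(x) = q(y) = 0` and `h(x, y) = 1`: the middle column is a twisted
cross product of `x` and `y` (`exists_isModelPoint`), and it is unique (`eq_of_columns`). Such pairs
lift along square-zero ideals (`exists_deform`): lift the entries arbitrarily, then correct `x` by a
multiple of `y` and `y` by a multiple of `x`. The correction of `q` needs an element `θ` with `T(θ)
= 1`. Such a `θ` exists because `β ^ i₀` is, up to a unit, itself a trace: that of `1` if `α = 0`,
and that of `s` otherwise. This is where the exact value of `i₀` enters.

After inverting `d` the extra equations become redundant, so the generic fibre of the model is the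
twisted `SU₃` (`isModel_iff_mem_SU3`). Smoothness gives flatness over `𝒪[K]`, so the coordinate ring
of the model embeds into that of its generic fibre. Hence the ideal of the model is already the full
preimage that defines the schematic adherence (`adherenceIdeal_eq`). -/

namespace SUModel

/-! ### Hermitian linear algebra: isotropic pairs and their deformations -/

section Unitary

variable {R S : Type*} [CommRing R] [CommRing S] [Algebra R S]

/-- A conjugation `x ↦ x̄` of the `R`-algebra `S` with `R`-valued norms, together with a surjective
linear form `T : S → R` such that `d T(x) = x + x̄`. -/
structure IsReducedTraceForm (τ : S →ₐ[R] S) (T : S →ₗ[R] R) (d : R) : Prop where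
  conj_conj (x : S) : τ (τ x) = x
  trace (x : S) : algebraMap R S d * algebraMap R S (T x) = x + τ x
  trace_conj (x : S) : T (τ x) = T x
  exists_norm (x : S) : ∃ n : R, algebraMap R S n = x * τ x
  exists_trace_eq_one : ∃ x, T x = 1

/-- The hermitian form on `S³` with matrix `antidiag(1, c, 1)`. -/
def hermitianForm (τ : S →ₐ[R] S) (c : S) (x y : Fin 3 → S) : S :=
  τ (x 2) * y 0 + c * (τ (x 1) * y 1) + τ (x 0) * y 2

/-- The quadratic form `T(x̄₃ x₁) + N(x₂)` on `S³`, with values in `R ⊆ S`. -/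
def reducedForm (τ : S →ₐ[R] S) (T : S →ₗ[R] R) (x : Fin 3 → S) : S :=
  algebraMap R S (T (τ (x 2) * x 0)) + x 1 * τ (x 1)

/-- The equations of the integral model, for a matrix with entries in `S`. -/
def IsModelPoint (τ : S →ₐ[R] S) (T : S →ₗ[R] R) (c : S) (g : Matrix (Fin 3) (Fin 3) S) : Prop :=
  antiTranspose (g.map τ) * hermitianMatrix c * g = hermitianMatrix c ∧
  algebraMap R S (T (τ (g 2 0) * g 0 0)) = -(g 1 0 * τ (g 1 0)) ∧
  algebraMap R S (T (τ (g 2 2) * g 0 2)) = -(g 1 2 * τ (g 1 2))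

lemma antiTranspose_mul_apply (τ : S →ₐ[R] S) (c : S) (g h : Matrix (Fin 3) (Fin 3) S)
    (i j : Fin 3) : (antiTranspose (g.map τ) * hermitianMatrix c * h) i j =
      hermitianForm τ c (fun k => g k (Fin.rev i)) (fun k => h k j) := by
  simp only [hermitianForm, hermitianMatrix, antiTranspose, Matrix.mul_apply,
    Fin.sum_univ_three, Matrix.of_apply, Matrix.map_apply]
  simp [Fin.rev]
  ring

lemma isModelPoint_iff {τ : S →ₐ[R] S} {T : S →ₗ[R] R} {c : S} {g : Matrix (Fin 3) (Fin 3) S} :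
    IsModelPoint τ T c g ↔
      antiTranspose (g.map τ) * hermitianMatrix c * g = hermitianMatrix c ∧
      reducedForm τ T (fun k => g k 0) = 0 ∧ reducedForm τ T (fun k => g k 2) = 0 := by
  simp only [IsModelPoint, reducedForm, eq_neg_iff_add_eq_zero]

/-- A special unitary matrix is determined by its first and third columns. -/
lemma eq_of_columns {τ : S →ₐ[R] S} {c : S} {g h : Matrix (Fin 3) (Fin 3) S}
    (hg : antiTranspose (g.map τ) * hermitianMatrix c * g = hermitianMatrix c)
    (hh : antiTranspose (h.map τ) * hermitianMatrix c * h = hermitianMatrix c)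
    (dg : g.det = 1) (dh : h.det = 1) (h0 : ∀ i, g i 0 = h i 0) (h2 : ∀ i, g i 2 = h i 2) :
    g = h := by
  -- As `det h = 1`, this is `h⁻¹ g`. Its outer columns are trivial because `g` and `h` share
  -- theirs. Its outer rows are trivial because `D P = h* D g`, whose outer rows involve only the
  -- outer columns of `h`, and `D` has entries `1` there.
  set P := h.adjugate * g with hP
  have key : antiTranspose (h.map τ) * hermitianMatrix c = hermitianMatrix c * h.adjugate := by
    have := congrArg (· * h.adjugate) hh
    simpa only [Matrix.mul_assoc, Matrix.mul_adjugate, dh, one_smul, Matrix.mul_one] using this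
  have hDP : hermitianMatrix c * P = antiTranspose (h.map τ) * hermitianMatrix c * g := by
    rw [key, hP, Matrix.mul_assoc]
  have row (i : Fin 3) (hi : i = 0 ∨ i = 2) (j : Fin 3) :
      P i j = (1 : Matrix (Fin 3) (Fin 3) S) i j := by
    have e1 := congrFun (congrFun hDP i) j
    have e2 := congrFun (congrFun hg i) j
    rw [antiTranspose_mul_apply] at e1 e2
    have : (fun k => h k (Fin.rev i)) = fun k => g k (Fin.rev i) := by
      rcases hi with rfl | rfl
      · exact funext fun k => (h2 k).symm
      · exact funext fun k => (h0 k).symm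
    rw [this, e2, hermitianMatrix, Matrix.diagonal_mul] at e1
    rcases hi with rfl | rfl <;> simpa [Matrix.diagonal_apply, Matrix.one_apply] using e1
  have hh1 : h.adjugate * h = 1 := by rw [Matrix.adjugate_mul, dh, one_smul]
  have col (j : Fin 3) (hj : ∀ i, g i j = h i j) (i : Fin 3) :
      P i j = (1 : Matrix (Fin 3) (Fin 3) S) i j := by
    rw [← hh1, hP, Matrix.mul_apply, Matrix.mul_apply]
    simp only [hj]
  have c0 := col 0 h0
  have c2 := col 2 h2
  have r0 := row 0 (.inl rfl)
  have r2 := row 2 (.inr rfl)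
  have hdet : P.det = 1 := by
    rw [hP, Matrix.det_mul, Matrix.det_adjugate, dg, dh, one_pow, one_mul]
  -- The middle row of `D P = D` only gives `c * P 1 1 = c`, and `c` may be a zero divisor; the
  -- determinant supplies the last entry.
  have h11 : P 1 1 = 1 := by
    rw [Matrix.det_fin_three] at hdet
    simpa [c0, c2, r0, r2] using hdet
  have hP1 : P = 1 := by
    ext i j
    fin_cases i
    · exact r0 j
    · fin_cases j
      · exact c0 1
      · simpa using h11
      · exact c2 1
    · exact r2 j
  calc g = h * h.adjugate * g := by rw [Matrix.mul_adjugate, dh, one_smul, Matrix.one_mul]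
    _ = h := by rw [Matrix.mul_assoc, ← hP, hP1, Matrix.mul_one]

variable {τ : S →ₐ[R] S} {T : S →ₗ[R] R} {d : R}

lemma conj_hermitianForm (hT : IsReducedTraceForm τ T d) (x y : Fin 3 → S) :
    τ (hermitianForm τ (algebraMap R S d) x y) = hermitianForm τ (algebraMap R S d) y x := by
  simp only [hermitianForm, map_add, map_mul, hT.conj_conj, AlgHom.commutes]
  ring

/-- Isotropy for the reduced form is thus stronger than isotropy for the hermitian form, and
equivalent to it as soon as `d` is a non-zero-divisor in `S`. -/
lemma hermitianForm_self (hT : IsReducedTraceForm τ T d) (x : Fin 3 → S) :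
    hermitianForm τ (algebraMap R S d) x x = algebraMap R S d * reducedForm τ T x := by
  rw [reducedForm, mul_add, hT.trace, hermitianForm, map_mul, hT.conj_conj]
  ring

/-- Two isotropic vectors with product `1` are the outer columns of a point of the model. -/
lemma exists_isModelPoint (hT : IsReducedTraceForm τ T d) {x y : Fin 3 → S}
    (hx : reducedForm τ T x = 0) (hy : reducedForm τ T y = 0)
    (hxy : hermitianForm τ (algebraMap R S d) x y = 1) :
    ∃ g : Matrix (Fin 3) (Fin 3) S, g.det = 1 ∧ IsModelPoint τ T (algebraMap R S d) g ∧
      (∀ i, g i 0 = x i) ∧ ∀ i, g i 2 = y i := by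
  set c := algebraMap R S d with hc
  have hτc : τ c = c := τ.commutes d
  have hxx : hermitianForm τ c x x = 0 := by rw [hermitianForm_self hT, hx, mul_zero]
  have hyy : hermitianForm τ c y y = 0 := by rw [hermitianForm_self hT, hy, mul_zero]
  have hyx : hermitianForm τ c y x = 1 := by rw [← conj_hermitianForm hT, hxy, map_one]
  -- The conjugate cross product of `x` and `y`, rescaled by the hermitian matrix without dividing
  -- by `c`: `h(x, z)` and `h(y, z)` are `-c` times conjugates of determinants with a repeated
  -- column.
  let z : Fin 3 → S := ![-(c * τ (x 0 * y 1 - y 0 * x 1)), τ (x 0 * y 2 - y 0 * x 2),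
    -(c * τ (x 1 * y 2 - y 1 * x 2))]
  let g : Matrix (Fin 3) (Fin 3) S := !![x 0, z 0, y 0; x 1, z 1, y 1; x 2, z 2, y 2]
  have g0 : (fun k => g k 0) = x := by ext k; fin_cases k <;> rfl
  have g1 : (fun k => g k 1) = z := by ext k; fin_cases k <;> rfl
  have g2 : (fun k => g k 2) = y := by ext k; fin_cases k <;> rfl
  have hxz : hermitianForm τ c x z = 0 := by
    simp [hermitianForm, z]; ring
  have hyz : hermitianForm τ c y z = 0 := by
    simp [hermitianForm, z]; ring
  have hzx : hermitianForm τ c z x = 0 := by rw [← conj_hermitianForm hT, hxz, map_zero]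
  have hzy : hermitianForm τ c z y = 0 := by rw [← conj_hermitianForm hT, hyz, map_zero]
  -- The left side is the expansion of `det g` along the middle column. By a Lagrange identity it
  -- equals the Gram determinant `h(x, y) h(y, x) - h(x, x) h(y, y)`.
  have gram : τ (x 0 * y 2 - y 0 * x 2) * (x 0 * y 2 - y 0 * x 2) +
      c * ((x 1 * y 2 - y 1 * x 2) * τ (x 0 * y 1 - y 0 * x 1) +
        τ (x 1 * y 2 - y 1 * x 2) * (x 0 * y 1 - y 0 * x 1)) = 1 := by
    have : τ (x 0 * y 2 - y 0 * x 2) * (x 0 * y 2 - y 0 * x 2) +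
      c * ((x 1 * y 2 - y 1 * x 2) * τ (x 0 * y 1 - y 0 * x 1) +
        τ (x 1 * y 2 - y 1 * x 2) * (x 0 * y 1 - y 0 * x 1)) =
        hermitianForm τ c x y * hermitianForm τ c y x -
          hermitianForm τ c x x * hermitianForm τ c y y := by
      simp only [hermitianForm, map_sub, map_mul]; ring
    rw [this, hxx, hxy, hyx]; ring
  have hzz : hermitianForm τ c z z = c := by
    have : hermitianForm τ c z z = c * (τ (x 0 * y 2 - y 0 * x 2) * (x 0 * y 2 - y 0 * x 2) +
      c * ((x 1 * y 2 - y 1 * x 2) * τ (x 0 * y 1 - y 0 * x 1) +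
        τ (x 1 * y 2 - y 1 * x 2) * (x 0 * y 1 - y 0 * x 1))) := by
      simp [hermitianForm, z, hτc, hT.conj_conj]; ring
    rw [this, gram, mul_one]
  refine ⟨g, ?_, isModelPoint_iff.2 ⟨?_, ?_, ?_⟩, congrFun g0, congrFun g2⟩
  · rw [Matrix.det_fin_three, ← gram]
    simp [g, z]
    ring
  · ext i j
    rw [antiTranspose_mul_apply]
    fin_cases i <;> fin_cases j <;>
      simp [Fin.rev, g0, g1, g2, hxx, hxy, hxz, hyx, hyy, hyz, hzx, hzy, hzz, hermitianMatrix]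
  · rw [g0, hx]
  · rw [g2, hy]

/-- First-order deformation of a vector `x` with `T(x̄₃ x₁) + N(x₂) = r` to an isotropic one, with the
help of a vector `y` such that `h(x, y) ≡ 1`. -/
lemma reducedForm_deform (hT : IsReducedTraceForm τ T d) {Z : Ideal S}
    (hZ : ∀ a ∈ Z, ∀ b ∈ Z, a * b = 0) (hτZ : ∀ a ∈ Z, τ a ∈ Z) {x y : Fin 3 → S} {r : R} {θ ν : S}
    (hr : reducedForm τ T x = algebraMap R S r) (hrZ : algebraMap R S r ∈ Z) (hν : ν ∈ Z)
    (hxy : hermitianForm τ (algebraMap R S d) x y - 1 ∈ Z) (hθ : T θ = 1) :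
    reducedForm τ T (fun i => (1 - ν) * x i - algebraMap R S r * θ * y i) = 0 := by
  set c := algebraMap R S r with hc
  have hτc : τ c = c := τ.commutes r
  have hcν := hZ c hrZ ν hν
  have hcν' := hZ c hrZ _ (hτZ ν hν)
  have hνν := hZ ν hν _ (hτZ ν hν)
  have hcc := hZ c hrZ c hrZ
  set t : S → S := fun a => algebraMap R S (T a) with ht
  have tadd (a b : S) : t (a + b) = t a + t b := by simp [ht]
  have tmul (s : R) (a : S) : t (algebraMap R S s * a) = algebraMap R S s * t a := by
    simp only [ht, ← Algebra.smul_def, map_smul]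
    rw [smul_eq_mul, map_mul, Algebra.smul_def]
  have tconj (a : S) : t (τ a) = t a := by simp only [ht, hT.trace_conj]
  have tr (a : S) : algebraMap R S d * t a = a + τ a := hT.trace a
  -- Since `ν * τ ν = 0`, this is the norm of `1 - ν`. It has to be written as an element of `R`,
  -- because `T` is only `R`-linear.
  have hn : algebraMap R S (1 - d * T ν) = 1 - (ν + τ ν) := by
    rw [map_sub, map_mul, map_one, hT.trace]
  set n := algebraMap R S (1 - d * T ν) with hndef
  have hnc : n * c = c := by rw [hn]; linear_combination -hcν - hcν'
  have e1 : τ ((1 - ν) * x 2 - c * θ * y 2) * ((1 - ν) * x 0 - c * θ * y 0) =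
      n * (τ (x 2) * x 0) + algebraMap R S (-r) * (τ (θ * τ (x 0) * y 2) + θ * τ (x 2) * y 0) := by
    simp only [map_sub, map_mul, map_one, map_neg, hτc, hT.conj_conj, hn, ← hc]
    linear_combination (τ (x 2) * x 0) * hνν + (x 0 * τ θ * τ (y 2)) * hcν
      + (y 0 * θ * τ (x 2)) * hcν' + (τ θ * τ (y 2) * θ * y 0) * hcc
  have e2 : ((1 - ν) * x 1 - c * θ * y 1) * τ ((1 - ν) * x 1 - c * θ * y 1) =
      n * (x 1 * τ (x 1)) - c * (algebraMap R S d * t (θ * (τ (x 1) * y 1))) := by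
    rw [tr]
    simp only [map_sub, map_mul, map_one, hτc, hT.conj_conj, hn]
    linear_combination (τ (x 1) * x 1) * hνν + (x 1 * τ θ * τ (y 1)) * hcν
      + (y 1 * θ * τ (x 1)) * hcν' + (τ θ * τ (y 1) * θ * y 1) * hcc
  -- The cross terms of `e1` and `e2` assemble to `c T(θ h(x, y))`. As `c` kills `h(x, y) - 1`, this
  -- is `c T(θ) = c`, exactly the defect to be removed.
  have e3 : c * (t (θ * τ (x 0) * y 2) + t (θ * τ (x 2) * y 0) +
      algebraMap R S d * t (θ * (τ (x 1) * y 1))) = c := by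
    rw [← tmul, ← tadd, ← tadd, ← tmul]
    have : c * (θ * τ (x 0) * y 2 + θ * τ (x 2) * y 0 +
        algebraMap R S d * (θ * (τ (x 1) * y 1))) = c * θ := by
      have := hZ c hrZ _ hxy
      rw [hermitianForm] at this
      linear_combination θ * this
    rw [this, tmul]
    simp [ht, hθ, hc]
  have hr' : t (τ (x 2) * x 0) + x 1 * τ (x 1) = c := hr
  change t _ + _ = 0
  rw [e1, e2, tadd, hndef, tmul, tmul, tadd, tconj, ← hndef, map_neg, ← hc]
  linear_combination n * hr' - e3 + hnc

lemma reducedForm_mem_range (hT : IsReducedTraceForm τ T d) (x : Fin 3 → S) :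
    ∃ r : R, reducedForm τ T x = algebraMap R S r := by
  obtain ⟨n, hn⟩ := hT.exists_norm (x 1)
  exact ⟨_, by rw [reducedForm, ← hn, map_add]⟩

/-- Infinitesimal deformation of a pair of vectors to a pair of isotropic vectors with product `1`. -/
lemma exists_deform (hT : IsReducedTraceForm τ T d) {Z : Ideal S}
    (hZ : ∀ a ∈ Z, ∀ b ∈ Z, a * b = 0) (hτZ : ∀ a ∈ Z, τ a ∈ Z) {x y : Fin 3 → S}
    (hx : reducedForm τ T x ∈ Z) (hy : reducedForm τ T y ∈ Z)
    (hxy : hermitianForm τ (algebraMap R S d) x y - 1 ∈ Z) :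
    ∃ x' y' : Fin 3 → S, (∀ i, x' i - x i ∈ Z) ∧ (∀ i, y' i - y i ∈ Z) ∧
      reducedForm τ T x' = 0 ∧ reducedForm τ T y' = 0 ∧
      hermitianForm τ (algebraMap R S d) x' y' = 1 := by
  obtain ⟨r, hr⟩ := reducedForm_mem_range hT x
  obtain ⟨s, hs⟩ := reducedForm_mem_range hT y
  obtain ⟨θ, hθ⟩ := hT.exists_trace_eq_one
  have hrZ : algebraMap R S r ∈ Z := hr ▸ hx
  have hsZ : algebraMap R S s ∈ Z := hs ▸ hy
  have hyx : hermitianForm τ (algebraMap R S d) y x - 1 ∈ Z := by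
    rw [← conj_hermitianForm hT, ← map_one τ, ← map_sub]
    exact hτZ _ hxy
  have hxx := hermitianForm_self hT x
  have hyy := hermitianForm_self hT y
  -- The defect of `h(x, y)` is absorbed in `x` alone, through the factor `1 - ν` with `ν = h(y, x)
  -- - 1`; for `y` the parameter `ν` is `0`.
  refine ⟨_, _, fun i => ?_, fun i => ?_,
    reducedForm_deform hT hZ hτZ hr hrZ hyx hxy hθ,
    reducedForm_deform hT hZ hτZ hs hsZ Z.zero_mem hyx hθ, ?_⟩
  · rw [show ∀ a b c e : S, (1 - a) * b - c * θ * e - b = -(b * a) - θ * e * c by intros; ring]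
    exact Z.sub_mem (Z.neg_mem (Z.mul_mem_left _ hyx)) (Z.mul_mem_left _ hrZ)
  · rw [show ∀ b c e : S, (1 - 0) * b - c * θ * e - b = -(θ * e * c) by intros; ring]
    exact Z.neg_mem (Z.mul_mem_left _ hsZ)
  · have h1 := hZ _ hrZ _ hsZ
    have h2 := hZ _ hxy _ hxy
    have h3 := hZ _ hxy _ hsZ
    have hconj := conj_hermitianForm hT y x
    rw [hr] at hxx
    rw [hs] at hyy
    set c := algebraMap R S r
    set e := algebraMap R S s
    have hτc : τ c = c := τ.commutes r
    set ε := hermitianForm τ (algebraMap R S d) x y - 1 with hε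
    set ν := hermitianForm τ (algebraMap R S d) y x - 1 with hν
    have hτν : τ ν = ε := by rw [hν, hε, map_sub, map_one, hconj]
    have expand : hermitianForm τ (algebraMap R S d) (fun i => (1 - ν) * x i - c * θ * y i)
        (fun i => (1 - 0) * y i - e * θ * x i) =
        (1 - ε) * hermitianForm τ (algebraMap R S d) x y
        - (1 - ε) * e * θ * hermitianForm τ (algebraMap R S d) x x
        - c * τ θ * hermitianForm τ (algebraMap R S d) y y
        + c * τ θ * (e * θ) * hermitianForm τ (algebraMap R S d) y x := by
      simp only [hermitianForm, map_sub, map_mul, map_one, hτc, hτν]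
      ring
    rw [expand, hxx, hyy]
    have h4 : hermitianForm τ (algebraMap R S d) x y = 1 + ε := by rw [hε]; ring
    rw [h4]
    -- The main term is `(1 - ε) * (1 + ε) = 1 - ε ^ 2 = 1`. The other terms contain `c * e = 0`,
    -- because `h(x, x)` is a multiple of `c` and `h(y, y)` one of `e`.
    linear_combination -h2 + (-(1 - ε) * θ * algebraMap R S d - τ θ * algebraMap R S d
      + τ θ * θ * hermitianForm τ (algebraMap R S d) y x) * h1

end Unitary

/-! ### The integral model: base change, representability and smoothness -/

section Model

open Algebra.TensorProduct (includeLeft)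

variable {A B : Type u} [CommRing A] [CommRing B] [Algebra A B]

/-- The conjugation of `R ⊗[A] B` as an `R`-algebra homomorphism. -/
noncomputable def conjₐ (R : Type v) [CommRing R] [Algebra A R] (τ : B →ₐ[A] B) : R ⊗[A] B →ₐ[R] R ⊗[A] B :=
  Algebra.TensorProduct.map (AlgHom.id R R) τ

/-- The base change of a linear form on `B`, as an `R`-linear form on `R ⊗[A] B`. -/
noncomputable def formₗ (R : Type v) [CommRing R] [Algebra A R] (T : B →ₗ[A] A) : R ⊗[A] B →ₗ[R] R :=
  (TensorProduct.AlgebraTensorModule.rid A R R).toLinearMap ∘ₗ T.baseChange R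

variable {R : Type v} [CommRing R] [Algebra A R] {R' : Type w} [CommRing R'] [Algebra A R']

@[simp] lemma conjₐ_tmul (τ : B →ₐ[A] B) (r : R) (b : B) :
    conjₐ R τ (r ⊗ₜ b) = r ⊗ₜ τ b := rfl

@[simp] lemma formₗ_tmul (T : B →ₗ[A] A) (r : R) (b : B) :
    formₗ R T (r ⊗ₜ b) = T b • r := rfl

lemma map_conjₐ (f : R →ₐ[A] R') (τ : B →ₐ[A] B) (x : R ⊗[A] B) :
    Algebra.TensorProduct.map f (AlgHom.id A B) (conjₐ R τ x) =
      conjₐ R' τ (Algebra.TensorProduct.map f (AlgHom.id A B) x) := by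
  induction x with
  | zero => simp
  | add x y hx hy => simp only [map_add, hx, hy]
  | tmul r b => simp

lemma formₗ_map (f : R →ₐ[A] R') (T : B →ₗ[A] A) (x : R ⊗[A] B) :
    formₗ R' T (Algebra.TensorProduct.map f (AlgHom.id A B) x) = f (formₗ R T x) := by
  induction x with
  | zero => simp
  | add x y hx hy => simp only [map_add, hx, hy]
  | tmul r b => simp

lemma map_algebraMap_left (f : R →ₐ[A] R') (r : R) :
    Algebra.TensorProduct.map f (AlgHom.id A B) (algebraMap R (R ⊗[A] B) r) =
      algebraMap R' (R' ⊗[A] B) (f r) := by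
  simp [Algebra.TensorProduct.algebraMap_apply]

lemma tmul_algebraMap (r : R) (a : A) :
    r ⊗ₜ[A] algebraMap A B a = algebraMap R (R ⊗[A] B) (a • r) := by
  rw [Algebra.algebraMap_eq_smul_one, ← TensorProduct.smul_tmul]
  rfl

/-- The identities for `τ` and `T` are linear in `x`, so pure tensors suffice. The norm is
quadratic: on a sum it produces the cross term `x ȳ + y x̄`, a trace, which lies in `R` by the
linear case. -/
lemma IsReducedTraceForm.baseChange {τ : B →ₐ[A] B} {T : B →ₗ[A] A} {d : A}
    (h : IsReducedTraceForm τ T d) (R : Type v) [CommRing R] [Algebra A R] :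
    IsReducedTraceForm (conjₐ R τ) (formₗ R T) (algebraMap A R d) where
  conj_conj x := by
    induction x with
    | zero => simp
    | add x y hx hy => simp only [map_add, hx, hy]
    | tmul r b => simp [h.conj_conj]
  trace x := by
    induction x with
    | zero => simp
    | add x y hx hy => simp only [map_add, mul_add, hx, hy]; ring
    | tmul r b =>
      rw [conjₐ_tmul, ← TensorProduct.tmul_add, ← h.trace, ← map_mul (algebraMap A B),
        tmul_algebraMap, formₗ_tmul, ← map_mul]
      simp [Algebra.smul_def, mul_assoc]
  trace_conj x := by
    induction x with
    | zero => simp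
    | add x y hx hy => simp only [map_add, hx, hy]
    | tmul r b => simp [h.trace_conj]
  exists_norm x := by
    have trace (x : R ⊗[A] B) : ∃ r : R, algebraMap R (R ⊗[A] B) r = x + conjₐ R τ x := by
      induction x with
      | zero => exact ⟨0, by simp⟩
      | add x y hx hy =>
        obtain ⟨r, hr⟩ := hx
        obtain ⟨s, hs⟩ := hy
        exact ⟨r + s, by rw [map_add, hr, hs, map_add]; ring⟩
      | tmul r b =>
        refine ⟨(d * T b) • r, ?_⟩
        rw [conjₐ_tmul, ← TensorProduct.tmul_add, ← h.trace, ← map_mul, tmul_algebraMap]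
    have invol (x : R ⊗[A] B) : conjₐ R τ (conjₐ R τ x) = x := by
      induction x with
      | zero => simp
      | add x y hx hy => simp only [map_add, hx, hy]
      | tmul r b => simp [h.conj_conj]
    induction x with
    | zero => exact ⟨0, by simp⟩
    | add x y hx hy =>
      obtain ⟨r, hr⟩ := hx
      obtain ⟨s, hs⟩ := hy
      obtain ⟨q, hq⟩ := trace (x * conjₐ R τ y)
      refine ⟨r + s + q, ?_⟩
      rw [map_add, map_add, hr, hs, hq, map_add, map_mul, invol]
      ring
    | tmul r b =>
      obtain ⟨n, hn⟩ := h.exists_norm b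
      refine ⟨n • (r * r), ?_⟩
      rw [conjₐ_tmul, Algebra.TensorProduct.tmul_mul_tmul, ← hn, tmul_algebraMap]
  exists_trace_eq_one := by
    obtain ⟨x, hx⟩ := h.exists_trace_eq_one
    exact ⟨1 ⊗ₜ x, by simp [hx]⟩

/-- The integral model: the special linear matrices over `R ⊗[A] B` that satisfy its equations. -/
noncomputable def IsModel (τ : B →ₐ[A] B) (T : B →ₗ[A] A) (d : A) (g : Matrix (Fin 3) (Fin 3) (R ⊗[A] B)) : Prop :=
  IsModelPoint (conjₐ R τ) (formₗ R T) (algebraMap R (R ⊗[A] B) (algebraMap A R d)) g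

/-- The differences of the two sides of the equations of the integral model. -/
noncomputable def modelEquations (τ : B →ₐ[A] B) (T : B →ₗ[A] A) (d : A)
    (g : Matrix (Fin 3) (Fin 3) (R ⊗[A] B)) : (Fin 3 × Fin 3) ⊕ Bool → R ⊗[A] B
  | .inl (i, j) => hermitianForm (conjₐ R τ) (algebraMap R (R ⊗[A] B) (algebraMap A R d))
      (fun k => g k (Fin.rev i)) (fun k => g k j) -
        hermitianMatrix (algebraMap R (R ⊗[A] B) (algebraMap A R d)) i j
  | .inr false => reducedForm (conjₐ R τ) (formₗ R T) fun k => g k 0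
  | .inr true => reducedForm (conjₐ R τ) (formₗ R T) fun k => g k 2

lemma isModel_iff {τ : B →ₐ[A] B} {T : B →ₗ[A] A} {d : A}
    {g : Matrix (Fin 3) (Fin 3) (R ⊗[A] B)} :
    IsModel τ T d g ↔ ∀ i, modelEquations τ T d g i = 0 := by
  simp only [IsModel, isModelPoint_iff, Sum.forall, Prod.forall, Bool.forall_bool, modelEquations,
    sub_eq_zero, ← Matrix.ext_iff, antiTranspose_mul_apply]

lemma map_hermitianForm (f : R →ₐ[A] R') (τ : B →ₐ[A] B) (d : A) (x y : Fin 3 → R ⊗[A] B) :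
    Algebra.TensorProduct.map f (AlgHom.id A B)
      (hermitianForm (conjₐ R τ) (algebraMap R (R ⊗[A] B) (algebraMap A R d)) x y) =
    hermitianForm (conjₐ R' τ) (algebraMap R' (R' ⊗[A] B) (algebraMap A R' d))
      (fun k => Algebra.TensorProduct.map f (AlgHom.id A B) (x k))
      (fun k => Algebra.TensorProduct.map f (AlgHom.id A B) (y k)) := by
  simp only [hermitianForm, map_add, map_mul, map_conjₐ, map_algebraMap_left, AlgHom.commutes]

lemma map_reducedForm (f : R →ₐ[A] R') (τ : B →ₐ[A] B) (T : B →ₗ[A] A) (x : Fin 3 → R ⊗[A] B) :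
    Algebra.TensorProduct.map f (AlgHom.id A B) (reducedForm (conjₐ R τ) (formₗ R T) x) =
    reducedForm (conjₐ R' τ) (formₗ R' T)
      (fun k => Algebra.TensorProduct.map f (AlgHom.id A B) (x k)) := by
  simp only [reducedForm, map_add, map_mul, map_conjₐ, map_algebraMap_left, ← formₗ_map]

lemma map_hermitianMatrix {S S' F : Type*} [CommRing S] [CommRing S'] [FunLike F S S']
    [RingHomClass F S S'] (f : F) (c : S) (i j : Fin 3) :
    f (hermitianMatrix c i j) = hermitianMatrix (f c) i j := by
  simp only [hermitianMatrix, Matrix.diagonal_apply]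
  split_ifs
  · fin_cases i <;> simp
  · simp

lemma map_modelEquations (f : R →ₐ[A] R') (τ : B →ₐ[A] B) (T : B →ₗ[A] A) (d : A)
    (g : Matrix (Fin 3) (Fin 3) (R ⊗[A] B)) (i) :
    Algebra.TensorProduct.map f (AlgHom.id A B) (modelEquations τ T d g i) =
      modelEquations τ T d (g.map (Algebra.TensorProduct.map f (AlgHom.id A B))) i := by
  obtain ⟨i, j⟩ | _ | _ := i
  · simp only [modelEquations, map_sub, map_hermitianForm, map_hermitianMatrix,
      map_algebraMap_left, AlgHom.commutes, Matrix.map_apply]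
  · simp only [modelEquations, map_reducedForm, Matrix.map_apply]
  · simp only [modelEquations, map_reducedForm, Matrix.map_apply]

variable [Module.Free A B] [Module.Finite A B]

/-- The ideal of the integral model in the coordinate ring of the Weil restriction. -/
noncomputable def modelIdeal (τ : B →ₐ[A] B) (T : B →ₗ[A] A) (d : A) : Ideal (CoordRing A B) :=
  Ideal.span (Set.range fun x : ((Fin 3 × Fin 3) ⊕ Bool) × Module.Free.ChooseBasisIndex A B =>
    coord (modelEquations τ T d universalMatrix x.1) x.2)

lemma pointsEquiv_val (f : CoordRing A B →ₐ[A] R) : (pointsEquiv f).1 =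
    universalMatrix.map (Algebra.TensorProduct.map f (AlgHom.id A B)) := rfl

lemma pointsEquiv_comp (f : R →ₐ[A] R') (h : CoordRing A B →ₐ[A] R) :
    (pointsEquiv (f.comp h)).1 =
      (pointsEquiv h).1.map (Algebra.TensorProduct.map f (AlgHom.id A B)) := by
  ext i j
  simp only [pointsEquiv_val, Matrix.map_apply]
  rw [← AlgHom.comp_apply, ← Algebra.TensorProduct.map_comp]
  simp

/-- The equations commute with base change, so at any point they are the images of those at the
universal point; an element of `R ⊗[A] B` vanishes exactly when its coordinates do. Hence
`modelIdeal` cuts out the model functorially in `R`. -/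
lemma modelIdeal_le_ker_iff {τ : B →ₐ[A] B} {T : B →ₗ[A] A} {d : A} (f : CoordRing A B →ₐ[A] R) :
    modelIdeal τ T d ≤ RingHom.ker f ↔ IsModel τ T d (pointsEquiv f).1 := by
  rw [modelIdeal, Ideal.span_le, Set.range_subset_iff, isModel_iff]
  simp only [SetLike.mem_coe, RingHom.mem_ker, ← coord_map, map_modelEquations, Prod.forall,
    pointsEquiv_val]
  refine forall_congr' fun i => ⟨fun h => coord_ext fun k => ?_, fun h k => ?_⟩
  · rw [h k]; simp [coord]
  · rw [h]; simp [coord]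

lemma forall_modelIdeal_iff {τ : B →ₐ[A] B} {T : B →ₗ[A] A} {d : A}
    (g : Matrix.SpecialLinearGroup (Fin 3) (R ⊗[A] B)) :
    (∀ F ∈ modelIdeal τ T d, pointsEquiv.symm g F = 0) ↔ IsModel τ T d g.1 := by
  rw [show (∀ F ∈ modelIdeal τ T d, pointsEquiv.symm g F = 0) ↔
    modelIdeal τ T d ≤ RingHom.ker (pointsEquiv.symm g) from Iff.rfl, modelIdeal_le_ker_iff,
    Equiv.apply_symm_apply]

/-- Points of the integral model lift along quotients by square-zero ideals. -/
lemma IsReducedTraceForm.exists_lift {τ : B →ₐ[A] B} {T : B →ₗ[A] A} {d : A}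
    (h : IsReducedTraceForm τ T d) (I : Ideal R) (hI : I ^ 2 = ⊥)
    (g : Matrix.SpecialLinearGroup (Fin 3) ((R ⧸ I) ⊗[A] B)) (hg : IsModel τ T d g.1) :
    ∃ g' : Matrix.SpecialLinearGroup (Fin 3) (R ⊗[A] B), IsModel τ T d g'.1 ∧
      g'.1.map (Algebra.TensorProduct.map (Ideal.Quotient.mkₐ A I) (AlgHom.id A B)) = g.1 := by
  set p := Algebra.TensorProduct.map (Ideal.Quotient.mkₐ A I) (AlgHom.id A B) with hp
  have psurj : Function.Surjective p :=
    TensorProduct.map_surjective (Ideal.Quotient.mkₐ_surjective A I) Function.surjective_id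
  -- The kernel is the extension of `I`, so it again has square zero.
  have hker : RingHom.ker p = I.map (includeLeft : R →ₐ[A] R ⊗[A] B) := by
    have hI : RingHom.ker (Ideal.Quotient.mkₐ A I) = I := Ideal.mk_ker
    conv_rhs => rw [← hI]
    exact Algebra.TensorProduct.rTensor_ker _ (Ideal.Quotient.mkₐ_surjective A I)
  have hZ : ∀ a ∈ RingHom.ker p, ∀ b ∈ RingHom.ker p, a * b = 0 := by
    intro a ha b hb
    have hab : a * b ∈ RingHom.ker p * RingHom.ker p := Ideal.mul_mem_mul ha hb
    rw [hker, ← Ideal.map_mul, ← pow_two, hI, Ideal.map_bot] at hab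
    exact hab
  have hτZ : ∀ a ∈ RingHom.ker p, conjₐ R τ a ∈ RingHom.ker p := by
    intro a ha
    rw [RingHom.mem_ker] at ha ⊢
    rw [hp, map_conjₐ, ← hp, ha, map_zero]
  obtain ⟨hh, h0, h2⟩ := isModelPoint_iff.1 hg
  choose x hx using fun i => psurj (g.1 i 0)
  choose y hy using fun i => psurj (g.1 i 2)
  have hxy : hermitianForm (conjₐ (R ⧸ I) τ) (algebraMap _ _ (algebraMap A (R ⧸ I) d))
      (fun k => g.1 k 0) (fun k => g.1 k 2) = 1 := by
    -- The anti-transpose reverses the indices: entry `(i, j)` pairs column `rev i` with column `j`,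
    -- so `(2, 2)` pairs the first column with the third.
    have := congrFun (congrFun hh 2) 2
    rw [antiTranspose_mul_apply] at this
    simpa [hermitianMatrix] using this
  obtain ⟨x', y', hx', hy', qx, qy, hxy'⟩ := exists_deform (h.baseChange R) hZ hτZ
    (x := x) (y := y)
    (by rw [RingHom.mem_ker, hp, map_reducedForm, ← hp]; simpa only [hx] using h0)
    (by rw [RingHom.mem_ker, hp, map_reducedForm, ← hp]; simpa only [hy] using h2)
    (by rw [RingHom.mem_ker, map_sub, map_one, hp, map_hermitianForm, ← hp, sub_eq_zero]
        simpa only [hx, hy] using hxy)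
  obtain ⟨g', dg', hg', g0, g2⟩ := exists_isModelPoint (h.baseChange R) qx qy hxy'
  refine ⟨⟨g', dg'⟩, hg', ?_⟩
  have hmap : IsModel τ T d (g'.map p) := by
    rw [isModel_iff]
    intro i
    rw [hp, ← map_modelEquations, isModel_iff.1 hg' i, map_zero]
  have hdet : (g'.map p).det = 1 := by
    rw [← AlgHom.mapMatrix_apply, ← AlgHom.map_det, dg', map_one]
  -- No lift of the middle column was chosen; the reduction of `g'` agrees with `g` because both are
  -- determined by their outer columns.
  refine eq_of_columns hmap.1 hh hdet g.2 (fun i => ?_) fun i => ?_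
  · change p (g' i 0) = _
    rw [g0, ← hx, ← sub_eq_zero, ← map_sub]
    exact hx' i
  · change p (g' i 2) = _
    rw [g2, ← hy, ← sub_eq_zero, ← map_sub]
    exact hy' i

/-- The infinitesimal lifting criterion, with homomorphisms out of the coordinate ring read as
matrices through `pointsEquiv`. -/
lemma IsReducedTraceForm.formallySmooth {τ : B →ₐ[A] B} {T : B →ₗ[A] A} {d : A}
    (h : IsReducedTraceForm τ T d) :
    Algebra.FormallySmooth A (CoordRing A B ⧸ modelIdeal τ T d) := by
  refine .of_comp_surjective fun R _ _ I hI f => ?_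
  have hf : IsModel τ T d
      (pointsEquiv (f.comp (Ideal.Quotient.mkₐ A (modelIdeal τ T d)))).1 := by
    rw [← modelIdeal_le_ker_iff]
    intro F hF
    rw [RingHom.mem_ker, AlgHom.comp_apply, Ideal.Quotient.mkₐ_eq_mk,
      Ideal.Quotient.eq_zero_iff_mem.2 hF, map_zero]
  obtain ⟨g, hg, hgf⟩ := h.exists_lift I hI _ hf
  refine ⟨Ideal.Quotient.liftₐ _ (pointsEquiv.symm g) ((forall_modelIdeal_iff g).2 hg), ?_⟩
  refine Ideal.Quotient.algHom_ext A (pointsEquiv.injective (Subtype.ext ?_))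
  rw [← hgf, AlgHom.comp_assoc]
  refine (pointsEquiv_comp _ _).trans ?_
  congr 1
  exact congrArg Subtype.val (pointsEquiv.apply_symm_apply g)

instance : Algebra.FiniteType A (CoordRing A B) :=
  .of_surjective (CoordRing.mk A B) (Ideal.Quotient.mkₐ_surjective A _)

lemma IsReducedTraceForm.smooth [IsNoetherianRing A] {τ : B →ₐ[A] B} {T : B →ₗ[A] A} {d : A}
    (h : IsReducedTraceForm τ T d) : Algebra.Smooth A (CoordRing A B ⧸ modelIdeal τ T d) where
  formallySmooth := h.formallySmooth
  finitePresentation := Algebra.FinitePresentation.of_finiteType.1 inferInstance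

end Model

/-! ### The generic fibre and the schematic adherence -/

section Generic

section Twist

variable {R S : Type*} [CommRing R] [CommRing S] [Algebra R S]

/-- Here `g' = P⁻¹ g P` with `P = diag(1, p, 1)`, and `P⁻¹` carries the form `antidiag(1, 1, 1)` to
`antidiag(1, p τ(p), 1)`. Right multiplication by `P` then only scales the entry `(i, j)` of the
equation by the unit `τ(P_i) P_j`. -/
lemma twisted_unitary_iff (τ : S →ₐ[R] S) {p q : S} (hpq : p * q = 1)
    (g : Matrix (Fin 3) (Fin 3) S) {g' : Matrix (Fin 3) (Fin 3) S}
    (hg' : g' = !![g 0 0, p * g 0 1, g 0 2; q * g 1 0, g 1 1, q * g 1 2;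
      g 2 0, p * g 2 1, g 2 2]) :
    antiTranspose (g'.map τ) * hermitianMatrix (p * τ p) * g' = hermitianMatrix (p * τ p) ↔
      antiTranspose (g.map τ) * g = 1 := by
  have h1 : hermitianMatrix (1 : S) = 1 := by
    rw [hermitianMatrix, ← Matrix.diagonal_one]
    congr 1
    ext i
    fin_cases i <;> rfl
  have hpq' : τ p * τ q = 1 := by rw [← map_mul, hpq, map_one]
  have hp (i : Fin 3) : IsUnit (![1, p, 1] i) := by
    fin_cases i
    · exact isUnit_one
    · exact .of_mul_eq_one _ hpq
    · exact isUnit_one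
  have hp' (i : Fin 3) : IsUnit (![1, τ p, 1] i) := by
    fin_cases i
    · exact isUnit_one
    · exact .of_mul_eq_one _ hpq'
    · exact isUnit_one
  have e : antiTranspose (g.map τ) * g = antiTranspose (g.map τ) * hermitianMatrix 1 * g := by
    rw [h1, Matrix.mul_one]
  rw [e, ← h1, ← Matrix.ext_iff, ← Matrix.ext_iff]
  refine forall_congr' fun i => forall_congr' fun j => ?_
  rw [antiTranspose_mul_apply, antiTranspose_mul_apply]
  have e1 : hermitianForm τ (p * τ p) (fun k => g' k (Fin.rev i)) (fun k => g' k j) =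
      ![1, τ p, 1] i * ![1, p, 1] j *
        hermitianForm τ 1 (fun k => g k (Fin.rev i)) (fun k => g k j) := by
    have h2 : p * τ p * (τ q * q) = 1 := by linear_combination hpq + hpq' * p * q
    subst hg'
    fin_cases i <;> fin_cases j <;> simp [hermitianForm, Fin.rev]
    · linear_combination (τ (g 1 2) * g 1 0) * h2
    · linear_combination (τ (g 1 2) * g 1 1 * p) * hpq'
    · linear_combination (τ (g 1 2) * g 1 2) * h2
    · linear_combination (τ (g 1 1) * g 1 0 * τ p) * hpq
    · ring
    · linear_combination (τ (g 1 1) * g 1 2 * τ p) * hpq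
    · linear_combination (τ (g 1 0) * g 1 0) * h2
    · linear_combination (τ (g 1 0) * g 1 1 * p) * hpq'
    · linear_combination (τ (g 1 0) * g 1 2) * h2
  have e2 : hermitianMatrix (p * τ p) i j =
      ![1, τ p, 1] i * ![1, p, 1] j * hermitianMatrix 1 i j := by
    fin_cases i <;> fin_cases j <;> simp [hermitianMatrix, mul_comm]
  rw [e1, e2, ((hp' i).mul (hp j)).mul_right_inj]

end Twist

variable {A K L B : Type u}
  [CommRing A] [Field K] [Algebra A K] [Field L] [Algebra K L] [Algebra A L] [IsScalarTower A K L]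
  [CommRing B] [Algebra A B] [Algebra B L] [IsScalarTower A B L]
  {S : Type u} [CommRing S] [Algebra K S] [Algebra A S] [IsScalarTower A K S]

lemma toGeneric_tmul (s : S) (b : B) :
    toGeneric A K L B S (s ⊗ₜ b) = s ⊗ₜ algebraMap B L b := by
  refine (Algebra.TensorProduct.lift_tmul _ _ _ _ _).trans ?_
  simp

lemma toGeneric_conjₐ {σ : L ≃ₐ[K] L} {τ : B →ₐ[A] B}
    (hστ : ∀ b, algebraMap B L (τ b) = σ (algebraMap B L b)) (x : S ⊗[A] B) :
    toGeneric A K L B S (conjₐ S τ x) =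
      Algebra.TensorProduct.map (AlgHom.id K S) (σ : L →ₐ[K] L) (toGeneric A K L B S x) := by
  induction x with
  | zero => simp
  | add x y hx hy => simp only [map_add, hx, hy]
  | tmul s b => simp [toGeneric_tmul, hστ]

/-- The twisting factors are inverse to each other. -/
lemma twistFactor_mul (S : Type u) [CommRing S] [Algebra K S] (i : ℕ) {t : L} (ht : t ≠ 0) :
    ((1 : S) ⊗ₜ[K] t) ^ i * (1 : S) ⊗ₜ[K] (t ^ i)⁻¹ = 1 := by
  rw [Algebra.TensorProduct.tmul_pow, one_pow, Algebra.TensorProduct.tmul_mul_tmul,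
    mul_inv_cancel₀ (pow_ne_zero _ ht), one_mul, Algebra.TensorProduct.one_def]

lemma det_twist (i : ℕ) {t : L} (ht : t ≠ 0) (g : Matrix (Fin 3) (Fin 3) (S ⊗[K] L)) :
    (twist i t g).det = g.det := by
  have h := twistFactor_mul (K := K) S i ht
  rw [Matrix.det_fin_three, Matrix.det_fin_three]
  simp only [twist, Matrix.of_apply, Matrix.cons_val]
  linear_combination (-(g 0 1 * g 1 0 * g 2 2) + g 0 1 * g 1 2 * g 2 0 + g 0 2 * g 1 0 * g 2 1
    - g 0 0 * g 1 2 * g 2 1) * h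

lemma exists_twist (i : ℕ) {t : L} (ht : t ≠ 0) (W : Matrix (Fin 3) (Fin 3) (S ⊗[K] L))
    (hW : W.det = 1) :
    ∃ g : Matrix.SpecialLinearGroup (Fin 3) (S ⊗[K] L), W = twist i t g.1 := by
  set p : S ⊗[K] L := ((1 : S) ⊗ₜ[K] t) ^ i with hp
  set q : S ⊗[K] L := (1 : S) ⊗ₜ[K] (t ^ i)⁻¹ with hq
  have h : p * q = 1 := twistFactor_mul S i ht
  have h' : q * p = 1 := by rw [mul_comm, h]
  let g : Matrix (Fin 3) (Fin 3) (S ⊗[K] L) :=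
    !![W 0 0, q * W 0 1, W 0 2; p * W 1 0, W 1 1, p * W 1 2; W 2 0, q * W 2 1, W 2 2]
  have hg : W = twist i t g := by
    ext i j
    fin_cases i <;> fin_cases j <;> simp [twist, g, ← hp, ← hq, ← mul_assoc, h, h']
  exact ⟨⟨g, by rw [← det_twist i ht g, ← hg, hW]⟩, hg⟩

variable [IsDomain A] [IsFractionRing A K] [IsIntegralClosure B A L] [Algebra.IsAlgebraic K L]

/-- On the generic fibre, the equations of the integral model define the twisted `SU₃`. -/
lemma isModel_iff_mem_SU3 {σ : L ≃ₐ[K] L} {τ : B →ₐ[A] B} {T : B →ₗ[A] A} {d : A} {i : ℕ} {t : B}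
    (hστ : ∀ b, algebraMap B L (τ b) = σ (algebraMap B L b)) (h : IsReducedTraceForm τ T d)
    (hd : algebraMap A B d = (t * τ t) ^ i) (hd0 : d ≠ 0) (ht : algebraMap B L t ≠ 0)
    {z : Matrix.SpecialLinearGroup (Fin 3) (S ⊗[A] B)}
    {g : Matrix.SpecialLinearGroup (Fin 3) (S ⊗[K] L)}
    (hz : z.1.map (toGeneric A K L B S) = twist i (algebraMap B L t) g.1) :
    IsModel τ T d z.1 ↔ g ∈ SU3 σ S := by
  have hinj := (toGeneric_bijective A K L B S).injective
  have hdS : IsUnit (algebraMap S (S ⊗[A] B) (algebraMap A S d)) := by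
    rw [IsScalarTower.algebraMap_apply A K S]
    have : algebraMap A K d ≠ 0 := fun h0 =>
      hd0 (IsFractionRing.injective A K (h0.trans (map_zero _).symm))
    exact (this.isUnit.map (algebraMap K S)).map _
  have hself := hermitianForm_self (h.baseChange S)
  have hform : IsModel τ T d z.1 ↔ antiTranspose (z.1.map (conjₐ S τ)) *
      hermitianMatrix (algebraMap S (S ⊗[A] B) (algebraMap A S d)) * z.1 =
      hermitianMatrix (algebraMap S (S ⊗[A] B) (algebraMap A S d)) := by
    -- Over a `K`-algebra `d` is invertible, so `q(x) = 0` follows from `d q(x) = h(x, x) = 0`. The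
    -- entries `(2, 0)` and `(0, 2)` of the unitary equation are the values `h(x, x)` for the first
    -- and third columns.
    refine isModelPoint_iff.trans ⟨And.left, fun hh => ⟨hh, ?_, ?_⟩⟩
    · rw [← hdS.mul_right_eq_zero, ← hself]
      have := congrFun (congrFun hh 2) 0
      rw [antiTranspose_mul_apply] at this
      simpa [hermitianMatrix] using this
    · rw [← hdS.mul_right_eq_zero, ← hself]
      have := congrFun (congrFun hh 0) 2
      rw [antiTranspose_mul_apply] at this
      simpa [hermitianMatrix] using this
  set p : S ⊗[K] L := ((1 : S) ⊗ₜ[K] algebraMap B L t) ^ i with hp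
  set q : S ⊗[K] L := (1 : S) ⊗ₜ[K] (algebraMap B L t ^ i)⁻¹ with hq
  have hpq : p * q = 1 := twistFactor_mul S i ht
  have hdp : toGeneric A K L B S (algebraMap S (S ⊗[A] B) (algebraMap A S d)) =
      p * Algebra.TensorProduct.map (AlgHom.id K S) (σ : L →ₐ[K] L) p := by
    have e : algebraMap S (S ⊗[A] B) (algebraMap A S d) = 1 ⊗ₜ ((t * τ t) ^ i) := by
      rw [← hd, tmul_algebraMap, Algebra.smul_def, mul_one]
    rw [e, toGeneric_tmul, hp]
    simp [hστ, mul_pow, Algebra.TensorProduct.tmul_pow]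
  rw [hform]
  refine Iff.trans ?_ (twisted_unitary_iff
    (Algebra.TensorProduct.map (AlgHom.id K S) (σ : L →ₐ[K] L)) hpq g.1 (g' := _) hz)
  rw [← Matrix.ext_iff, ← Matrix.ext_iff]
  refine forall_congr' fun i => forall_congr' fun j => ?_
  rw [antiTranspose_mul_apply, antiTranspose_mul_apply, ← hinj.eq_iff, map_hermitianMatrix, hdp]
  simp only [hermitianForm, map_add, map_mul, toGeneric_conjₐ hστ, hdp, Matrix.map_apply]

variable [Module.Free A B] [Module.Finite A B] [IsNoetherianRing A]

lemma evalGeneric_tmul (z : Matrix.SpecialLinearGroup (Fin 3) (S ⊗[A] B)) (F : CoordRing A B) :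
    evalGeneric K z (1 ⊗ₜ F) = pointsEquiv.symm z F := by
  refine (Algebra.TensorProduct.lift_tmul _ _ _ _ _).trans ?_
  rw [map_one, one_mul]

/-- The equations of the integral model generate the ideal of the schematic adherence. -/
lemma adherenceIdeal_eq {σ : L ≃ₐ[K] L} {τ : B →ₐ[A] B} {T : B →ₗ[A] A} {d : A} {i : ℕ} {t : B}
    (hστ : ∀ b, algebraMap B L (τ b) = σ (algebraMap B L b)) (h : IsReducedTraceForm τ T d)
    (hd : algebraMap A B d = (t * τ t) ^ i) (hd0 : d ≠ 0) (ht : algebraMap B L t ≠ 0) :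
    adherenceIdeal A σ i t = modelIdeal τ T d := by
  refine le_antisymm (fun F hF => ?_) fun F hF S _ _ _ _ z ⟨g, hg, hz⟩ => ?_
  · have := h.smooth
    have hflat : Module.Flat A (CoordRing A B ⧸ modelIdeal τ T d) := Algebra.Smooth.flat A _
    -- The universal point of the generic fibre of the model. It is a point of the twisted `SU₃`, so
    -- every `F` in the adherence ideal vanishes there.
    let f : CoordRing A B →ₐ[A] K ⊗[A] (CoordRing A B ⧸ modelIdeal τ T d) :=
      Algebra.TensorProduct.includeRight.comp (Ideal.Quotient.mkₐ A (modelIdeal τ T d))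
    have hf : IsModel τ T d (pointsEquiv f).1 := by
      rw [← modelIdeal_le_ker_iff]
      intro G hG
      rw [RingHom.mem_ker, AlgHom.comp_apply, Ideal.Quotient.mkₐ_eq_mk,
        Ideal.Quotient.eq_zero_iff_mem.2 hG, map_zero]
    obtain ⟨g, hg⟩ := exists_twist i ht ((pointsEquiv f).1.map (toGeneric A K L B _)) (by
      rw [← AlgHom.mapMatrix_apply, ← AlgHom.map_det, (pointsEquiv f).2, map_one])
    have h0 := hF _ (pointsEquiv f) ⟨g, (isModel_iff_mem_SU3 hστ h hd hd0 ht hg).1 hf, hg⟩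
    have h1 : f F = 0 := by
      rw [← Equiv.symm_apply_apply pointsEquiv f, ← evalGeneric_tmul (K := K)]
      exact h0
    -- Flatness of the model keeps `A → K` injective after tensoring, so vanishing on the generic
    -- fibre implies vanishing on the model.
    have inj : Function.Injective (Algebra.TensorProduct.includeRight :
        (CoordRing A B ⧸ modelIdeal τ T d) →ₐ[A] K ⊗[A] (CoordRing A B ⧸ modelIdeal τ T d)) :=
      Algebra.TensorProduct.includeRight_injective (IsFractionRing.injective A K)
    exact Ideal.Quotient.eq_zero_iff_mem.1 (inj (h1.trans (map_zero _).symm))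
  · refine (evalGeneric_tmul z F).trans ?_
    exact (forall_modelIdeal_iff z).2 ((isModel_iff_mem_SU3 hστ h hd hd0 ht hz).2 hg) F hF

end Generic

/-! ### The reduced trace of a ramified quadratic extension -/

section ReducedTrace

variable {A K L B : Type*} [CommRing A] [IsDomain A] [IsDiscreteValuationRing A]
  [Field K] [Algebra A K] [IsFractionRing A K] [Field L] [Algebra K L] [Algebra A L]
  [IsScalarTower A K L] [Algebra.IsQuadraticExtension K L] [Algebra.IsSeparable K L]
  [CommRing B] [Algebra A B] [Algebra B L] [IsScalarTower A B L] [IsIntegralClosure B A L]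

/-- The reduced trace satisfies the axioms; its surjectivity expresses the choice of `i₀`. -/
lemma isReducedTraceForm_reducedTrace (σ : L ≃ₐ[K] L) (hσ : σ ≠ 1) (hram : IsRamified A B) {t : B}
    (ht : Irreducible t) : ∃ d : A, d ≠ 0 ∧
      algebraMap A B d = (t * galRestrict A K L B σ t) ^ ramificationParameter A K L ∧
      IsReducedTraceForm (galRestrict A K L B σ : B →ₐ[A] B) (reducedTrace A K σ t) d := by
  classical
  have injA := algebraMap_inj (A := A) K (L := L)
  have injB : Function.Injective (algebraMap B L) := IsIntegralClosure.algebraMap_injective B A L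
  have : IsDomain B := injB.isDomain
  have injAB : Function.Injective (algebraMap A B) := by
    rw [IsScalarTower.algebraMap_eq A B L] at injA
    exact Function.Injective.of_comp injA
  obtain ⟨b, hb, hbt⟩ := exists_norm σ hσ hram ht
  obtain ⟨s, α, β, hgood, hn⟩ := parameter_spec σ hσ hram
  have hspec := reducedTrace_spec σ hσ hram ht
  set n := ramificationParameter A K L
  set τ := galRestrict A K L B σ with hτ
  set T := reducedTrace A K σ t
  have hστ (x : B) : algebraMap B L (τ x) = σ (algebraMap B L x) :=
    algebraMap_galRestrict_apply A σ x
  have hbB : algebraMap A B b = t * τ t := injB (by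
    rw [← IsScalarTower.algebraMap_apply, hbt, map_mul, hστ])
  have hd : algebraMap A B (b ^ n) = (t * τ t) ^ n := by rw [map_pow, hbB]
  have hd0 : b ^ n ≠ 0 := pow_ne_zero _ hb.ne_zero
  have hd0' : algebraMap A B (b ^ n) ≠ 0 := fun h0 => hd0 (injAB (h0.trans (map_zero _).symm))
  have hinv (x : B) : τ (τ x) = x := injB (by rw [hστ, hστ, SUModel.conj_conj])
  have htr (x : B) : algebraMap A B (b ^ n) * algebraMap A B (T x) = x + τ x := by
    rw [hd, mul_comm, hspec]
  refine ⟨b ^ n, hd0, hd, hinv, htr, fun x => ?_, fun x => ?_, ?_⟩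
  · apply injAB
    apply mul_left_cancel₀ hd0'
    exact (htr (τ x)).trans ((by rw [hinv, add_comm] : _ = x + τ x).trans (htr x).symm)
  · have hint : IsIntegral A (algebraMap B L (x * τ x)) :=
      (IsIntegralClosure.isIntegral A L _).algebraMap
    obtain ⟨a, ha⟩ := descend (A := A) (K := K) hint
      (fixed_mem hσ (by rw [map_mul, hστ, map_mul, SUModel.conj_conj σ, mul_comm]))
    exact ⟨a, injB (by rw [← IsScalarTower.algebraMap_apply, ha]; rfl)⟩
  -- The element defining `i₀` is a trace: `2` is that of `1`, and `α` is that of `s`. It is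
  -- associated to `b ^ n`, so `T x` is a unit, and rescaling `x` gives the value `1`.
  · obtain ⟨x, hx⟩ : ∃ x : B, algebraMap A B (if α = 0 then 2 else α) = x + τ x := by
      split_ifs with h0
      · exact ⟨1, by rw [map_one, map_ofNat, one_add_one_eq_two]⟩
      · refine ⟨IsIntegralClosure.mk' B s (integral_root hgood), injB ?_⟩
        rw [map_add, hστ, IsIntegralClosure.algebraMap_mk', conj_root hgood hσ,
          ← IsScalarTower.algebraMap_apply]
        ring
    have hassoc : Associated (b ^ n) (if α = 0 then 2 else α) := by
      rw [← IsDiscreteValuationRing.addVal_eq_iff_associated, hn, hb.addVal_pow]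
    obtain ⟨u, hu⟩ := hassoc
    have hTx : T x = u := by
      apply injAB
      apply mul_left_cancel₀ hd0'
      rw [htr, ← hx, ← map_mul, hu]
    exact ⟨(↑u⁻¹ : A) • x, by rw [map_smul, hTx, smul_eq_mul, Units.inv_mul]⟩

end ReducedTrace

end SUModel

/-! ### The main theorem -/

open SUModel in
theorem mainTheorem12 {K L : Type u} [Field K] [ValuativeRel K] [TopologicalSpace K]
    [IsNonarchimedeanLocalField K] [CharP 𝓀[K] 2] [Field L] [Algebra K L]
    [Algebra.IsQuadraticExtension K L] [Algebra.IsSeparable K L]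
    (hram : IsRamified 𝒪[K] (integralClosure 𝒪[K] L))
    (σ : L ≃ₐ[K] L) (hσ : σ ≠ 1)
    (t : integralClosure 𝒪[K] L) (ht : Irreducible t)
    (i₀ : ℕ) (hi₀ : i₀ = ramificationParameter 𝒪[K] K L)
    (τ : integralClosure 𝒪[K] L ≃ₐ[𝒪[K]] integralClosure 𝒪[K] L)
    (hτ : τ = galRestrict 𝒪[K] K L (integralClosure 𝒪[K] L) σ) :
    (∀ (R : Type v) [CommRing R] [Algebra 𝒪[K] R],
      adherencePoints 𝒪[K] σ i₀ t R =
        {g : Matrix.SpecialLinearGroup (Fin 3) (R ⊗[𝒪[K]] integralClosure 𝒪[K] L) |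
          antiTranspose (g.1.map (conj τ)) * hermitianMatrix (1 ⊗ₜ (t * τ t) ^ i₀) * g.1 =
              hermitianMatrix (1 ⊗ₜ (t * τ t) ^ i₀) ∧
          baseChangeForm (reducedTrace 𝒪[K] K σ t) (conj τ (g.1 2 0) * g.1 0 0) ⊗ₜ 1 =
              -(g.1 1 0 * conj τ (g.1 1 0)) ∧
          baseChangeForm (reducedTrace 𝒪[K] K σ t) (conj τ (g.1 2 2) * g.1 0 2) ⊗ₜ 1 =
              -(g.1 1 2 * conj τ (g.1 1 2))}) ∧
      Algebra.Smooth 𝒪[K] (AdherenceRing 𝒪[K] σ i₀ t) := by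
  obtain ⟨d, hd0, hd, h⟩ := isReducedTraceForm_reducedTrace σ hσ hram ht
  rw [← hτ, ← hi₀] at hd
  rw [← hτ] at h
  have hστ (b : integralClosure 𝒪[K] L) :
      algebraMap (integralClosure 𝒪[K] L) L (τ b) = σ (algebraMap (integralClosure 𝒪[K] L) L b) := by
    rw [hτ]
    exact algebraMap_galRestrict_apply 𝒪[K] σ b
  have ht0 : algebraMap (integralClosure 𝒪[K] L) L t ≠ 0 := fun h0 =>
    ht.ne_zero (IsIntegralClosure.algebraMap_injective _ 𝒪[K] L (h0.trans (map_zero _).symm))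
  have key := adherenceIdeal_eq (σ := σ) (i := i₀) (t := t) hστ h hd hd0 ht0
  refine ⟨fun R _ _ => ?_, ?_⟩
  · ext g
    rw [adherencePoints, Set.mem_ofPred_eq, key, forall_modelIdeal_iff, IsModel]
    -- In the statement `⊗ₜ` binds more tightly than `^`, so the middle entry of the hermitian
    -- matrix is a power of a pure tensor; it is the image of `d`.
    have e : algebraMap R (R ⊗[𝒪[K]] integralClosure 𝒪[K] L) (algebraMap 𝒪[K] R d) =
        (1 ⊗ₜ (t * τ t)) ^ i₀ := by
      rw [Algebra.TensorProduct.tmul_pow, one_pow, ← hd, tmul_algebraMap, Algebra.smul_def, mul_one]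
    rw [e]
    -- `conj` and `baseChangeForm` agree by definition with their `R`-linear versions `conjₐ` and
    -- `formₗ`, and `r ⊗ₜ 1` is `algebraMap` of `r`.
    exact Iff.rfl
  · have := h.smooth
    rwa [← key] at this
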